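/- Let $p$ be a prime, $k=p^r$ with $r\ge 1$, and let $m,n\ge 2$ be integers divisible by $k$. Let $G=(\mathbf{SL}_m\times\mathbf{SL}_n)/\boldsymbol\mu_k$, where $\boldsymbol\mu_k$ is embedded diagonally, $\zeta\mapsto(\zeta\cdot 1,\zeta\cdot 1)$, in the centre $\boldsymbol\mu_m\times\boldsymbol\mu_n$. Notation. Let $\Lambda_w=\mathbb Z^m/\mathbb Z(1,\dots,1)$ and $\Lambda_w'=\mathbb Z^n/\mathbb Z(1,\dots,1)$ be the weight lattices of $\mathbf{SL}_m$ and $\mathbf{SL}_n$, with fundamental weights $\omega_i=e_1+\dots+e_i$ $(1\le i\le m-1)$ and $\omega_j'=e_1'+\dots+e_j'$ $(1\le j\le n-1)$. Let $T_{sc}^*=\Lambda_w\oplus\Lambda_w'$, on which the Weyl group $W=S_m\times S_n$ acts by permuting coordinates, and let $$T^*=\Big\{([v],[v'])\in T_{sc}^*\ \Big|\ \sum_i v_i+\sum_j v_j'\equiv 0 \bmod k\Big\}$$ be the character group of the split maximal torus of $G$. Let $$q=\sum_{i=1}^{m-1}\omega_i^2-\sum_{i=1}^{m-2}\omega_i\omega_{i+1},\qquad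 q'=\sum_{j=1}^{n-1}\omega_j'^2-\sum_{j=1}^{n-2}\omega_j'\omega_{j+1}'$$ be the normalized Killing forms in $S^2(T_{sc}^*)^W$. Let $Q(G)=S^2(T^*)^W=S^2(T^*)\cap S^2(T_{sc}^*)^W$. Let $c_2\colon\mathbb Z[T_{sc}^*]\to S^2(T_{sc}^*)$ be the degree $2$ component of the ring homomorphism $\mathbb Z[T_{sc}^*]\to S^*(T_{sc}^*)/S^{\ge 3}(T_{sc}^*)$ with $e^{-\omega}\mapsto 1-\omega$ and $e^{\omega}\mapsto 1+\omega+\omega^2$ for every fundamental weight $\omega\in\{\omega_i,\omega_j'\}$, and let $\operatorname{Dec}(G)=c_2(\mathbb Z[T^*]^W)$. Let $v_2$ be the $2$-adic valuation. Then $$Q(G)=\Big\{dq+d'q'\ \Big|\ d,d'\in\mathbb Z,\ \tfrac{k-1}{k}(md+nd')\equiv 0 \bmod 2k\Big\}$$ and, as subgroups of $S^2(T_{sc}^*)$, $$\operatorname{Dec}(G)=\begin{cases}k\mathbb Zq\oplus k\mathbb Zq' & \text{if } p\ne 2,\text{ or } p=2 \text{ and } \min\{v_2(m),v_2(n)\}>v_2(k),\\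 k\mathbb Z(q-q')\oplus k\mathbb Z(q+q') & \text{if } p=2 \text{ and } v_2(m)=v_2(n)=v_2(k),\\ k\mathbb Zq\oplus 2k\mathbb Zq' & \text{if } p=2 \text{ and } v_2(m)>v_2(k)=v_2(n).\end{cases}$$ -/

import Mathlib

noncomputable section

namespace TypeA

open scoped PowerSeries

/-! Character lattices, Weyl group actions and invariants for the split semisimple group
`(SL_m × SL_n)/μ_k`, where `μ_k` is embedded diagonally by `ζ ↦ (ζ·1, ζ·1)`. -/

/-! ### The weight lattice of `SL_m` -/

/-- The weight lattice of `SL_m`, i.e. the character group of its diagonal torus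
`{(t_1, …, t_m) | ∏ t_i = 1}`: the class of `v` is the character `t ↦ ∏ t_i ^ v_i`. -/
abbrev WeightLattice (m : ℕ) : Type :=
  (Fin m → ℤ) ⧸ Submodule.span ℤ {(1 : Fin m → ℤ)}

/-- The fundamental weight `ω_{i+1} = e_1 + ⋯ + e_{i+1}` (the index `i` starts at `0`). -/
def fundamentalWeight (m : ℕ) (i : Fin (m - 1)) : WeightLattice m :=
  Submodule.Quotient.mk fun j => if j.val ≤ i.val then 1 else 0

/-- The pairing of weights with the simple coroots, `[v] ↦ (v_i - v_{i+1})_i`. -/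
def corootPairing (m : ℕ) : WeightLattice m →ₗ[ℤ] (Fin (m - 1) → ℤ) :=
  Submodule.liftQ _
    { toFun := fun v i => v ⟨i.val, by omega⟩ - v ⟨i.val + 1, by omega⟩
      map_add' := by intro v w; ext i; simp only [Pi.add_apply]; ring
      map_smul' := by
        intro c v; ext i
        simp only [Pi.smul_apply, smul_eq_mul, RingHom.id_apply]; ring }
    (by
      rw [Submodule.span_singleton_le_iff_mem, LinearMap.mem_ker]
      ext i
      simp)

theorem corootPairing_mk (m : ℕ) (v : Fin m → ℤ) (i : Fin (m - 1)) :
    corootPairing m (Submodule.Quotient.mk v) i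
      = v ⟨i.val, by omega⟩ - v ⟨i.val + 1, by omega⟩ := rfl

theorem corootPairing_fundamentalWeight (m : ℕ) (i j : Fin (m - 1)) :
    corootPairing m (fundamentalWeight m i) j = if i = j then 1 else 0 := by
  rw [fundamentalWeight, corootPairing_mk]
  simp only [Fin.ext_iff]
  split_ifs <;> omega

theorem eq_zero_of_corootPairing (m : ℕ) (x : WeightLattice m)
    (hx : corootPairing m x = 0) : x = 0 := by
  obtain ⟨v, rfl⟩ := Submodule.Quotient.mk_surjective _ x
  rw [Submodule.Quotient.mk_eq_zero, Submodule.mem_span_singleton]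
  rcases Nat.eq_zero_or_pos m with rfl | hm
  · exact ⟨0, by ext i; exact i.elim0⟩
  · refine ⟨v ⟨0, hm⟩, ?_⟩
    have key : ∀ j (hj : j < m), v ⟨j, hj⟩ = v ⟨0, hm⟩ := by
      intro j
      induction j with
      | zero => intro _; rfl
      | succ j ih =>
        intro hj
        have h := congrFun hx ⟨j, by omega⟩
        rw [corootPairing_mk] at h
        simp only [Pi.zero_apply] at h
        rw [← ih (by omega)]
        omega
    ext j
    simp [key j.val j.isLt]

/-- The fundamental weights form a `ℤ`-basis of the weight lattice; the coordinates are the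
pairings with the simple coroots. -/
def fundamentalBasis (m : ℕ) : Module.Basis (Fin (m - 1)) ℤ (WeightLattice m) :=
  Module.Basis.ofEquivFun
    (LinearEquiv.ofBijective (corootPairing m) (by
      constructor
      · rw [← LinearMap.ker_eq_bot, LinearMap.ker_eq_bot']
        exact eq_zero_of_corootPairing m
      · intro a
        refine ⟨∑ i, a i • fundamentalWeight m i, ?_⟩
        ext j
        simp [map_sum, Finset.sum_apply, corootPairing_fundamentalWeight]))

theorem fundamentalBasis_apply (m : ℕ) (i : Fin (m - 1)) :
    fundamentalBasis m i = fundamentalWeight m i := by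
  apply (fundamentalBasis m).repr.injective
  ext j
  rw [Module.Basis.repr_self]
  have h : (fundamentalBasis m).repr (fundamentalWeight m i) j
      = corootPairing m (fundamentalWeight m i) j := by
    simp only [fundamentalBasis, Module.Basis.ofEquivFun_repr_apply]
    rfl
  rw [h, corootPairing_fundamentalWeight, Finsupp.single_apply]

/-- The element `σ` of the Weyl group `S_m` of `SL_m` acts by permuting coordinates,
`e_i ↦ e_{σ i}`. -/
def permAct (m : ℕ) (σ : Equiv.Perm (Fin m)) : WeightLattice m →ₗ[ℤ] WeightLattice m :=
  Submodule.mapQ _ _ (LinearMap.funLeft ℤ ℤ (σ⁻¹ : Equiv.Perm (Fin m))) (by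
    rw [Submodule.span_singleton_le_iff_mem, Submodule.mem_comap]
    exact Submodule.subset_span rfl)

/-- The map `Λ_w → Λ_w/Λ_r = ℤ/m → ℤ/k`, `[v] ↦ ∑ v_i mod k`; it sends `ω_i` to `i`. It is the
restriction of characters to the subgroup `μ_k` of the centre `μ_m` of `SL_m`. -/
def classMap {k m : ℕ} (hm : k ∣ m) : WeightLattice m →ₗ[ℤ] ZMod k :=
  Submodule.liftQ _
    { toFun := fun v => ((∑ i, v i : ℤ) : ZMod k)
      map_add' := by intro v w; simp [Finset.sum_add_distrib]
      map_smul' := by intro c v; simp [Finset.mul_sum] }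
    (by
      rw [Submodule.span_singleton_le_iff_mem, LinearMap.mem_ker]
      simpa using (ZMod.natCast_eq_zero_iff m k).2 hm)

/-! ### The groups `SL_m × SL_n` and `(SL_m × SL_n)/μ_k` -/

/-- `T_sc^*`, the character group of the maximal torus of `SL_m × SL_n`. -/
abbrev Tsc (m n : ℕ) : Type := WeightLattice m × WeightLattice n

/-- The basis of `T_sc^*` consisting of the fundamental weights `ω_i`, `ω'_j`. -/
def tscBasis (m n : ℕ) : Module.Basis (Fin (m - 1) ⊕ Fin (n - 1)) ℤ (Tsc m n) :=
  (fundamentalBasis m).prod (fundamentalBasis n)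

/-- The action on `T_sc^*` of the Weyl group `W = S_m × S_n`. -/
def weylAct (m n : ℕ) (w : Equiv.Perm (Fin m) × Equiv.Perm (Fin n)) :
    Tsc m n →ₗ[ℤ] Tsc m n :=
  (permAct m w.1).prodMap (permAct n w.2)

/-- `T^*`, the character group of the maximal torus of `(SL_m × SL_n)/μ_k`: the characters
of the maximal torus of `SL_m × SL_n` that are trivial on the diagonal `μ_k`, that is, the
kernel of the sum `Λ_w/Λ_r ⊕ Λ'_w/Λ'_r → ℤ/k`. -/
def charLattice {k m n : ℕ} (hm : k ∣ m) (hn : k ∣ n) : AddSubgroup (Tsc m n) :=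
  (LinearMap.ker ((classMap hm).coprod (classMap hn))).toAddSubgroup

/-- The symmetric algebra `S^*(T_sc^*)`. -/
abbrev Sym (m n : ℕ) : Type := SymmetricAlgebra ℤ (Tsc m n)

/-- The action of the Weyl group on `S^*(T_sc^*)`. -/
def weylSym (m n : ℕ) (w : Equiv.Perm (Fin m) × Equiv.Perm (Fin n)) :
    Sym m n →ₐ[ℤ] Sym m n :=
  SymmetricAlgebra.lift (SymmetricAlgebra.ι ℤ (Tsc m n) ∘ₗ weylAct m n w)

/-- `S^2(L)` for a sublattice `L` of `T_sc^*`, as a subgroup of `S^2(T_sc^*)`. -/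
def symSq {m n : ℕ} (L : AddSubgroup (Tsc m n)) : AddSubgroup (Sym m n) :=
  AddSubgroup.closure
    {s | ∃ x ∈ L, ∃ y ∈ L,
      s = SymmetricAlgebra.ι ℤ (Tsc m n) x * SymmetricAlgebra.ι ℤ (Tsc m n) y}

/-- The `W`-invariant elements of `S^*(T_sc^*)`. -/
def symInvariants (m n : ℕ) : AddSubgroup (Sym m n) where
  carrier := {s | ∀ w, weylSym m n w s = s}
  zero_mem' := fun w => map_zero _
  add_mem' := fun ha hb w => by rw [map_add, ha w, hb w]
  neg_mem' := fun ha w => by rw [map_neg, ha w]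

/-- `Q(G) = S^2(T^*)^W` for `G = (SL_m × SL_n)/μ_k`. -/
def Q {k m n : ℕ} (hm : k ∣ m) (hn : k ∣ n) : AddSubgroup (Sym m n) :=
  symSq (charLattice hm hn) ⊓ symInvariants m n

/-- `∑_{i=1}^{r} x_i^2 - ∑_{i=1}^{r-1} x_i x_{i+1}`. -/
def killingSum {A : Type} [CommRing A] (r : ℕ) (x : Fin r → A) : A :=
  ∑ i, x i ^ 2 -
    ∑ i : Fin (r - 1), x ⟨i.val, by omega⟩ * x ⟨i.val + 1, by omega⟩

/-- The normalized Killing form `q` of `SL_m`. -/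
def q (m n : ℕ) : Sym m n :=
  killingSum (m - 1) fun i => SymmetricAlgebra.ι ℤ (Tsc m n) (fundamentalWeight m i, 0)

/-- The normalized Killing form `q'` of `SL_n`. -/
def q' (m n : ℕ) : Sym m n :=
  killingSum (n - 1) fun j => SymmetricAlgebra.ι ℤ (Tsc m n) (0, fundamentalWeight n j)

/-! ### The characteristic map and `Dec(G)` -/

/-- The unit `1 - a t` of `A⟦t⟧`, with inverse `1 + a t + a² t² + ⋯`. -/
def oneSubUnit {A : Type} [CommRing A] (a : A) : A⟦X⟧ˣ where
  val := 1 - PowerSeries.C a * PowerSeries.X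
  inv := PowerSeries.mk fun i => a ^ i
  val_inv := by
    ext i
    cases i with
    | zero => simp [sub_mul, mul_assoc]
    | succ i =>
      simp [sub_mul, mul_assoc, PowerSeries.coeff_succ_X_mul, PowerSeries.coeff_one, pow_succ']
  inv_val := by
    rw [mul_comm]
    ext i
    cases i with
    | zero => simp [sub_mul, mul_assoc]
    | succ i =>
      simp [sub_mul, mul_assoc, PowerSeries.coeff_succ_X_mul, PowerSeries.coeff_one, pow_succ']

/-- The homomorphism with `-ω ↦ 1 - ω t` and `ω ↦ 1 + ω t + ω² t² + ⋯` for each fundamental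
weight `ω`. The variable `t` records the degree. -/
def totalChern (m n : ℕ) : Multiplicative (Tsc m n) →* (Sym m n)⟦X⟧ where
  toFun lam := ((∏ i, oneSubUnit (SymmetricAlgebra.ι ℤ (Tsc m n) (tscBasis m n i))
    ^ (-((tscBasis m n).repr lam.toAdd i)) : (Sym m n)⟦X⟧ˣ) : (Sym m n)⟦X⟧)
  map_one' := by simp
  map_mul' := by
    intro a b
    rw [← Units.val_mul, ← Finset.prod_mul_distrib]
    congr 1
    refine Finset.prod_congr rfl fun i _ => ?_
    rw [← zpow_add]
    congr 1
    simp only [toAdd_mul, map_add, Finsupp.add_apply]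
    ring

/-- The map `c_2 : ℤ[T_sc^*] → S^2(T_sc^*)`: the degree `2` component of the ring homomorphism
with `e^{-ω} ↦ 1 - ω` and `e^ω ↦ 1 + ω + ω²` modulo degrees `≥ 3`, for each fundamental
weight `ω`. -/
def c2 (m n : ℕ) : AddMonoidAlgebra ℤ (Tsc m n) →+ Sym m n :=
  (PowerSeries.coeff (R := Sym m n) 2).toAddMonoidHom.comp
    (AddMonoidAlgebra.lift ℤ ((Sym m n)⟦X⟧) (Tsc m n) (totalChern m n) :
      AddMonoidAlgebra ℤ (Tsc m n) →ₐ[ℤ] (Sym m n)⟦X⟧).toRingHom.toAddMonoidHom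

/-- `ℤ[L]^W`, for a sublattice `L` of `T_sc^*`, as a subgroup of `ℤ[T_sc^*]`: the elements
`∑ a_λ e^λ` with `a_λ = 0` for `λ ∉ L` that are fixed by the Weyl group. -/
def groupRingInvariants {m n : ℕ} (L : AddSubgroup (Tsc m n)) :
    AddSubgroup (AddMonoidAlgebra ℤ (Tsc m n)) where
  carrier := {f | (∀ lam, lam ∉ L → f.coeff lam = 0) ∧
    ∀ w, AddMonoidAlgebra.mapDomain (weylAct m n w) f = f}
  zero_mem' := ⟨fun _ _ => rfl, fun w => AddMonoidAlgebra.mapDomain_zero _⟩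
  add_mem' := fun ha hb => ⟨fun lam h => by simp [ha.1 lam h, hb.1 lam h], fun w => by
    rw [AddMonoidAlgebra.mapDomain_add, ha.2 w, hb.2 w]⟩
  neg_mem' := fun {a} ha => ⟨fun lam h => by simp [ha.1 lam h], fun w => by
    have h : AddMonoidAlgebra.mapDomain (weylAct m n w) (-a + a) = 0 := by
      rw [neg_add_cancel, AddMonoidAlgebra.mapDomain_zero]
    rw [AddMonoidAlgebra.mapDomain_add, ha.2 w] at h
    exact eq_neg_of_add_eq_zero_left h⟩

/-- `Dec(G) = c_2(ℤ[T^*]^W)` for `G = (SL_m × SL_n)/μ_k`. -/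
def Dec {k m n : ℕ} (hm : k ∣ m) (hn : k ∣ n) : AddSubgroup (Sym m n) :=
  (groupRingInvariants (charLattice hm hn)).map (c2 m n)

/-- `D = ℤa ⊕ ℤb`, an internal direct sum of two infinite cyclic groups. -/
def IsDirectSumOf {A : Type} [AddCommGroup A] (D : AddSubgroup A) (a b : A) : Prop :=
  D = AddSubgroup.zmultiples a ⊔ AddSubgroup.zmultiples b ∧ LinearIndependent ℤ ![a, b]

end TypeA

end

/-! Everything rests on the identities `2q = ∑ e_i²` and `2q' = ∑ e'_j²` (`two_mul_q`,
`two_mul_q'`). Since `S^*` is a polynomial ring over `ℤ`, identities may be checked after doubling.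

For an invariant `f = ∑ a_λ e^λ`, one has `2 c_2(f) = ∑ a_λ λ²` (`two_mul_c2`). Expanding in
coordinates that the Weyl group permutes, the second moments of `f` have just one diagonal and one
off-diagonal value on each factor, `A, B` and `A', B'`. As `∑ e_i = ∑ e'_j = 0`, this gives `c_2(f)
= (A - B) q + (A' - B') q'` (`c2_eq`).

The upper bound on `Dec` is `exists_of_mem_Dec`. On `T^*` the total coordinate sum is `k z` with `z`
integral and invariant. Taking moments against it forces `k ∣ A - B` and `k ∣ A' - B'`. For even
`k`, the evenness of `z(1 + z)` yields one more parity condition, which couples the two quotients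
through `m/k` and `n/k`.

The lower bound comes from explicit Weyl-stable families: the weights `k e_i`, the differences `e_i
- e_j`, the weights of the `k`-th exterior power, and the mixed weights `(e_i, -e'_j)`. They
contribute the multiples `k²`, `2m`, `C(m-2, k-1)` of `q` and the element `n q + m q'`. By Lucas,
`C(m-1, k-1)` is prime to `p`, so Bezout arguments bring these down to the stated generators.

For `Q`, averaging over `W` and evaluating at coroots shows that every invariant is an integral
combination of `q` and `q'`. Such a combination lies in `S²(T^*)` exactly when `2k²` divides `d
m(m-1) + d' n(n-1)`. Necessity is seen by evaluating at `k` times a cocharacter of the torus of `G`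
(`dvd_of_mem_symSq`). Sufficiency follows by reducing modulo `S²(T^*)` to a multiple of `e_a²` for
one fixed `a` (`mem_symSq_of_dvd`). -/

noncomputable section

namespace TypeA

open SymmetricAlgebra (ι)
open scoped PowerSeries

/-! ### The weights of the standard representation -/

/-- The weight `e_i` of the standard representation of `SL_m`. -/
def stdWeight (m : ℕ) (i : Fin m) : WeightLattice m :=
  Submodule.Quotient.mk (Pi.single i 1)

theorem mk_eq_sum_stdWeight {m : ℕ} (v : Fin m → ℤ) :
    (Submodule.Quotient.mk v : WeightLattice m) = ∑ i, v i • stdWeight m i := by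
  have h : v = ∑ i, v i • (Pi.single i 1 : Fin m → ℤ) := by
    ext j
    simp [Finset.sum_apply, Pi.single_apply]
  conv_lhs => rw [h]
  simp only [← Submodule.mkQ_apply, map_sum, map_smul, stdWeight]

theorem sum_stdWeight (m : ℕ) : ∑ i, stdWeight m i = 0 := by
  have h := mk_eq_sum_stdWeight (1 : Fin m → ℤ)
  simp only [Pi.one_apply, one_smul] at h
  rw [← h, Submodule.Quotient.mk_eq_zero]
  exact Submodule.mem_span_singleton_self _

theorem permAct_mk {m : ℕ} (σ : Equiv.Perm (Fin m)) (v : Fin m → ℤ) :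
    permAct m σ (Submodule.Quotient.mk v) = Submodule.Quotient.mk fun i => v (σ⁻¹ i) := rfl

theorem permAct_stdWeight {m : ℕ} (σ : Equiv.Perm (Fin m)) (i : Fin m) :
    permAct m σ (stdWeight m i) = stdWeight m (σ i) := by
  rw [stdWeight, permAct_mk, stdWeight]
  congr 1
  ext j
  simp only [Pi.single_apply, Equiv.Perm.inv_def, Equiv.symm_apply_eq]

theorem permAct_mul {m : ℕ} (σ τ : Equiv.Perm (Fin m)) (x : WeightLattice m) :
    permAct m (σ * τ) x = permAct m σ (permAct m τ x) := by
  obtain ⟨v, rfl⟩ := Submodule.Quotient.mk_surjective _ x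
  simp [permAct_mk]

theorem classMap_mk {k m : ℕ} (hm : k ∣ m) (v : Fin m → ℤ) :
    classMap hm (Submodule.Quotient.mk v) = ((∑ i, v i : ℤ) : ZMod k) := rfl

theorem classMap_stdWeight {k m : ℕ} (hm : k ∣ m) (i : Fin m) :
    classMap hm (stdWeight m i) = 1 := by
  simp [stdWeight, classMap_mk]

theorem mem_charLattice {k m n : ℕ} {hm : k ∣ m} {hn : k ∣ n} {x : Tsc m n} :
    x ∈ charLattice hm hn ↔ classMap hm x.1 + classMap hn x.2 = 0 := by
  rfl

theorem fundamentalWeight_eq_sum (m : ℕ) (i : Fin (m - 1)) :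
    fundamentalWeight m i = ∑ j, if j.val ≤ i.val then stdWeight m j else 0 := by
  rw [fundamentalWeight, mk_eq_sum_stdWeight]
  simp [ite_smul]

/-- A weight fixed by the Weyl group vanishes. -/
theorem eq_zero_of_permAct_eq {m : ℕ} {x : WeightLattice m} (hx : ∀ σ, permAct m σ x = x) :
    x = 0 := by
  apply eq_zero_of_corootPairing
  ext i
  -- A simple reflection negates the pairing with its own coroot, so a fixed weight pairs to zero
  -- with it.
  have h := congrArg (fun y => corootPairing m y i)
    (hx (Equiv.swap ⟨i.val, by omega⟩ ⟨i.val + 1, by omega⟩))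
  obtain ⟨v, rfl⟩ := Submodule.Quotient.mk_surjective _ x
  simp only [permAct_mk, corootPairing_mk, Equiv.swap_inv, Equiv.swap_apply_left,
    Equiv.swap_apply_right] at h
  rw [corootPairing_mk, Pi.zero_apply]
  omega

/-- The representative of a weight whose coordinate sum lies in `[0, m)`. -/
def weightRep (m : ℕ) (x : WeightLattice m) (i : Fin m) : ℤ :=
  Quotient.out x i - (∑ j, Quotient.out x j) / m

theorem mk_weightRep {m : ℕ} (x : WeightLattice m) :
    Submodule.Quotient.mk (weightRep m x) = x := by
  have h : weightRep m x =
      Quotient.out x - ((∑ j, Quotient.out x j) / m) • (1 : Fin m → ℤ) := by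
    ext i
    simp [weightRep]
  rw [h, Submodule.Quotient.mk_sub, Submodule.Quotient.mk_smul,
    (Submodule.Quotient.mk_eq_zero _).2 (Submodule.mem_span_singleton_self (1 : Fin m → ℤ)),
    smul_zero, sub_zero]
  exact Quotient.out_eq x

theorem weightRep_mk {m : ℕ} (v : Fin m → ℤ) (i : Fin m) :
    weightRep m (Submodule.Quotient.mk v) i = v i - (∑ j, v j) / m := by
  have h : (Submodule.Quotient.mk (Quotient.out (Submodule.Quotient.mk v : WeightLattice m)) :
      WeightLattice m) = Submodule.Quotient.mk v := Quotient.out_eq _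
  rw [Submodule.Quotient.eq, Submodule.mem_span_singleton] at h
  obtain ⟨c, hc⟩ := h
  have hc' : ∀ j, Quotient.out (Submodule.Quotient.mk v : WeightLattice m) j = v j + c := by
    intro j
    have := congrFun hc j
    simp only [Pi.smul_apply, Pi.one_apply, smul_eq_mul, mul_one, Pi.sub_apply] at this
    omega
  have hm : (m : ℤ) ≠ 0 := by
    have := i.pos
    omega
  simp only [weightRep, hc', Finset.sum_add_distrib, Finset.sum_const, Finset.card_univ,
    Fintype.card_fin, nsmul_eq_mul, Int.add_mul_ediv_left _ _ hm]
  ring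

/-- The normalization depends only on the coordinate sum, which permutations preserve. The lift to
`ℤ^m` is not additive; equivariance is what the moment computations need. -/
theorem weightRep_permAct {m : ℕ} (σ : Equiv.Perm (Fin m)) (x : WeightLattice m) (i : Fin m) :
    weightRep m (permAct m σ x) i = weightRep m x (σ⁻¹ i) := by
  obtain ⟨v, rfl⟩ := Submodule.Quotient.mk_surjective _ x
  rw [permAct_mk, weightRep_mk, weightRep_mk, Equiv.sum_comp (σ⁻¹) v]

theorem eq_sum_weightRep {m : ℕ} (x : WeightLattice m) :
    x = ∑ i, weightRep m x i • stdWeight m i := by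
  rw [← mk_eq_sum_stdWeight, mk_weightRep]

/-! ### The normalized Killing form as a sum of squares -/

theorem two_mul_sum_range {A : Type} [CommRing A] (w : ℕ → A) (r : ℕ) :
    2 * (∑ i ∈ Finset.range (r + 1), w i ^ 2 - ∑ i ∈ Finset.range r, w i * w (i + 1))
      = w 0 ^ 2 + ∑ i ∈ Finset.range r, (w (i + 1) - w i) ^ 2 + w r ^ 2 := by
  induction r with
  | zero => simp; ring
  | succ r ih =>
    rw [Finset.sum_range_succ (fun i => w i ^ 2) (r + 1),
      Finset.sum_range_succ (fun i => w i * w (i + 1)) r,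
      Finset.sum_range_succ (fun i => (w (i + 1) - w i) ^ 2) r]
    linear_combination ih

/-- The fundamental weights are the partial sums of the `e_i`, so completing squares turns
consecutive differences into the `e_i`. The leftover last square is that of the final `e_i`, because
all the `e_i` sum to zero. -/
theorem two_mul_killingSum {A : Type} [CommRing A] {m : ℕ} (hm : 2 ≤ m)
    (g : WeightLattice m →ₗ[ℤ] A) :
    2 * killingSum (m - 1) (fun i => g (fundamentalWeight m i))
      = ∑ i, g (stdWeight m i) ^ 2 := by
  obtain ⟨r, rfl⟩ : ∃ r, m = r + 2 := ⟨m - 2, by omega⟩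
  set e : ℕ → A := fun j => if h : j < r + 2 then g (stdWeight (r + 2) ⟨j, h⟩) else 0 with he
  set w : ℕ → A := fun i => ∑ j ∈ Finset.range (i + 1), e j with hw
  have hsum : ∀ f : A → A, ∑ i, f (g (stdWeight (r + 2) i)) =
      ∑ j ∈ Finset.range (r + 2), f (e j) := by
    intro f
    rw [Finset.sum_range]
    simp [he]
  have hfw : ∀ i : Fin (r + 1), g (fundamentalWeight (r + 2) i) = w i := by
    intro i
    rw [fundamentalWeight_eq_sum, map_sum]
    have h1 : ∀ j : Fin (r + 2), g (if j.val ≤ i.val then stdWeight (r + 2) j else 0)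
        = (fun j : ℕ => if j ≤ i.val then e j else 0) j := by
      intro j
      split_ifs with h <;> simp [he, h]
    rw [Finset.sum_congr rfl fun j _ => h1 j,
      Fin.sum_univ_eq_sum_range (fun j : ℕ => if j ≤ i.val then e j else 0), hw,
      ← Finset.sum_filter]
    refine Finset.sum_congr ?_ fun _ _ => rfl
    ext j
    simp only [Finset.mem_filter, Finset.mem_range]
    omega
  have hzero : ∑ j ∈ Finset.range (r + 2), e j = 0 := by
    rw [← hsum (fun a => a), ← map_sum, sum_stdWeight, map_zero]
  have hlast : w r = - e (r + 1) := by
    rw [Finset.sum_range_succ] at hzero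
    exact eq_neg_of_add_eq_zero_left hzero
  have hdiff : ∀ i, w (i + 1) - w i = e (i + 1) := by
    intro i
    simp [hw, Finset.sum_range_succ _ (i + 1)]
  have hk : killingSum (r + 2 - 1) (fun i => g (fundamentalWeight (r + 2) i)) =
      ∑ i ∈ Finset.range (r + 1), w i ^ 2 - ∑ i ∈ Finset.range r, w i * w (i + 1) := by
    rw [killingSum, Finset.sum_range, Finset.sum_range]
    exact congrArg₂ _ (Finset.sum_congr rfl fun i _ => by rw [hfw])
      (Finset.sum_congr rfl fun i _ => congrArg₂ _ (hfw ⟨i.val, _⟩) (hfw ⟨i.val + 1, _⟩))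
  rw [hk, two_mul_sum_range, hsum (fun a => a ^ 2), Finset.sum_range_succ, Finset.sum_range_succ',
    hlast]
  simp only [hdiff]
  have h0 : w 0 = e 0 := by simp [hw]
  rw [h0]
  ring

/-- The element `e_i` of `S^1(T_sc^*)`. -/
def stdLeft (m n : ℕ) (i : Fin m) : Sym m n := ι ℤ (Tsc m n) (stdWeight m i, 0)

/-- The element `e'_j` of `S^1(T_sc^*)`. -/
def stdRight (m n : ℕ) (j : Fin n) : Sym m n := ι ℤ (Tsc m n) (0, stdWeight n j)

theorem two_mul_q {m : ℕ} (n : ℕ) (hm : 2 ≤ m) : 2 * q m n = ∑ i, stdLeft m n i ^ 2 :=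
  two_mul_killingSum hm (ι ℤ (Tsc m n) ∘ₗ LinearMap.inl ℤ _ _)

theorem two_mul_q' (m : ℕ) {n : ℕ} (hn : 2 ≤ n) : 2 * q' m n = ∑ j, stdRight m n j ^ 2 :=
  two_mul_killingSum hn (ι ℤ (Tsc m n) ∘ₗ LinearMap.inr ℤ _ _)

theorem sum_stdLeft (m n : ℕ) : ∑ i, stdLeft m n i = 0 := by
  have h := congrArg (ι ℤ (Tsc m n) ∘ₗ LinearMap.inl ℤ _ _) (sum_stdWeight m)
  rw [map_sum, map_zero] at h
  exact h

theorem sum_stdRight (m n : ℕ) : ∑ j, stdRight m n j = 0 := by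
  have h := congrArg (ι ℤ (Tsc m n) ∘ₗ LinearMap.inr ℤ _ _) (sum_stdWeight n)
  rw [map_sum, map_zero] at h
  exact h

theorem ι_eq_sum {m n : ℕ} (x : Tsc m n) :
    ι ℤ (Tsc m n) x = ∑ i, weightRep m x.1 i • stdLeft m n i
      + ∑ j, weightRep n x.2 j • stdRight m n j := by
  have h : x = LinearMap.inl ℤ _ _ x.1 + LinearMap.inr ℤ _ _ x.2 := by simp
  conv_lhs => rw [h, map_add, eq_sum_weightRep x.1, eq_sum_weightRep x.2]
  simp only [map_sum, map_smul]
  rfl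

theorem weylAct_apply {m n : ℕ} (w : Equiv.Perm (Fin m) × Equiv.Perm (Fin n)) (x : Tsc m n) :
    weylAct m n w x = (permAct m w.1 x.1, permAct n w.2 x.2) := rfl

theorem weylSym_ι {m n : ℕ} (w : Equiv.Perm (Fin m) × Equiv.Perm (Fin n)) (x : Tsc m n) :
    weylSym m n w (ι ℤ _ x) = ι ℤ _ (weylAct m n w x) := by
  simp [weylSym]

theorem zsmul_cancel {m n : ℕ} {c : ℤ} (hc : c ≠ 0) {a b : Sym m n} (h : c • a = c • b) :
    a = b := by
  apply (SymmetricAlgebra.equivMvPolynomial (tscBasis m n)).injective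
  have h2 := congrArg (SymmetricAlgebra.equivMvPolynomial (tscBasis m n)) h
  rw [map_zsmul, map_zsmul] at h2
  ext t
  have h3 := congrArg (MvPolynomial.coeff t) h2
  rw [MvPolynomial.coeff_smul, MvPolynomial.coeff_smul, smul_eq_mul, smul_eq_mul] at h3
  exact mul_left_cancel₀ hc h3

theorem two_mul_cancel {m n : ℕ} {a b : Sym m n} (h : 2 * a = 2 * b) : a = b := by
  refine zsmul_cancel (two_ne_zero (α := ℤ)) ?_
  simpa only [zsmul_eq_mul, Int.cast_ofNat] using h

theorem exists_perm_apply_eq {m : ℕ} {i j a b : Fin m} (hij : i ≠ j) (hab : a ≠ b) :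
    ∃ σ : Equiv.Perm (Fin m), σ i = a ∧ σ j = b := by
  refine ⟨Equiv.swap (Equiv.swap i a j) b * Equiv.swap i a, ?_, ?_⟩
  · rw [Equiv.Perm.mul_apply, Equiv.swap_apply_left, Equiv.swap_apply_of_ne_of_ne _ hab]
    intro h
    apply hij
    rw [← Equiv.swap_apply_left i a] at h
    exact (Equiv.swap i a).injective (by simpa using h)
  · rw [Equiv.Perm.mul_apply, Equiv.swap_apply_left]

/-- The symmetric group is doubly transitive, so `M` is a scalar matrix plus a constant one. The
constant part contributes a multiple of `(∑ g i)² = 0`. -/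
theorem sum_invariant_quadratic {m : ℕ} {A : Type} [CommRing A] (g : Fin m → A)
    (hg : ∑ i, g i = 0) (M : Fin m → Fin m → ℤ) (hM : ∀ (σ : Equiv.Perm (Fin m)) i j,
      M (σ i) (σ j) = M i j) {a b : Fin m} (hab : a ≠ b) :
    ∑ i, ∑ j, M i j • (g i * g j) = (M a a - M a b) • ∑ i, g i ^ 2 := by
  have h : ∀ i j, M i j • (g i * g j) =
      M a b • (g i * g j) + if i = j then (M a a - M a b) • (g i * g i) else 0 := by
    intro i j
    split_ifs with hij
    · subst hij
      rw [← hM (Equiv.swap i a) i i, Equiv.swap_apply_left, sub_smul]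
      abel
    · obtain ⟨σ, h1, h2⟩ := exists_perm_apply_eq hij hab
      rw [← hM σ i j, h1, h2, add_zero]
  simp only [h, Finset.sum_add_distrib, Finset.sum_ite_eq, Finset.mem_univ, if_true]
  simp only [← Finset.smul_sum, ← Finset.mul_sum, hg, mul_zero, smul_zero, zero_add,
    Finset.sum_const_zero, sq]

theorem sum_invariant_bilinear {m n : ℕ} {A : Type} [CommRing A] (g : Fin m → A) (g' : Fin n → A)
    (hg : ∑ i, g i = 0) (M : Fin m → Fin n → ℤ) (hM : ∀ (σ : Equiv.Perm (Fin m)) i j,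
      M (σ i) j = M i j) :
    ∑ i, ∑ j, M i j • (g i * g' j) = 0 := by
  rcases isEmpty_or_nonempty (Fin m) with _ | ⟨⟨a⟩⟩
  · simp
  · have h : ∀ i j, M i j = M a j := by
      intro i j
      rw [← hM (Equiv.swap i a) i j, Equiv.swap_apply_left]
    rw [Finset.sum_comm]
    simp only [h, ← Finset.smul_sum, ← Finset.sum_mul, hg, zero_mul, smul_zero,
      Finset.sum_const_zero]

/-! ### The characteristic map on invariants -/

/-- The power series `u` is `1 + x t + ((x² + y) / 2) t² + ⋯`. -/
def HasChern {A : Type} [CommRing A] (u : A⟦X⟧) (x y : A) : Prop :=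
  PowerSeries.coeff 0 u = 1 ∧ PowerSeries.coeff 1 u = x ∧ 2 * PowerSeries.coeff 2 u = x ^ 2 + y

theorem coeff_two_mul {A : Type} [CommRing A] (u v : A⟦X⟧) :
    PowerSeries.coeff 2 (u * v) = PowerSeries.coeff 0 u * PowerSeries.coeff 2 v
      + PowerSeries.coeff 1 u * PowerSeries.coeff 1 v
      + PowerSeries.coeff 2 u * PowerSeries.coeff 0 v := by
  rw [PowerSeries.coeff_mul, Finset.Nat.sum_antidiagonal_eq_sum_range_succ_mk]
  simp only [Finset.sum_range_succ, Finset.sum_range_zero, zero_add, Nat.sub_zero, Nat.sub_self,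
    Nat.reduceSub]

theorem coeff_one_mul {A : Type} [CommRing A] (u v : A⟦X⟧) :
    PowerSeries.coeff 1 (u * v) = PowerSeries.coeff 0 u * PowerSeries.coeff 1 v
      + PowerSeries.coeff 1 u * PowerSeries.coeff 0 v := by
  rw [PowerSeries.coeff_mul, Finset.Nat.antidiagonal_succ]
  simp

theorem coeff_zero_mul {A : Type} [CommRing A] (u v : A⟦X⟧) :
    PowerSeries.coeff 0 (u * v) = PowerSeries.coeff 0 u * PowerSeries.coeff 0 v := by
  rw [PowerSeries.coeff_mul]
  simp

theorem HasChern.one {A : Type} [CommRing A] : HasChern (1 : A⟦X⟧) 0 0 := by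
  simp [HasChern, PowerSeries.coeff_one]

/-- Formally `log u = x t + (y/2) t² + ⋯`, so both invariants are additive. -/
theorem HasChern.mul {A : Type} [CommRing A] {u v : A⟦X⟧} {x y x' y' : A}
    (hu : HasChern u x y) (hv : HasChern v x' y') : HasChern (u * v) (x + x') (y + y') := by
  obtain ⟨h0, h1, h2⟩ := hu
  obtain ⟨h0', h1', h2'⟩ := hv
  refine ⟨?_, ?_, ?_⟩
  · rw [coeff_zero_mul, h0, h0', one_mul]
  · rw [coeff_one_mul, h0, h1, h0', h1']; ring
  · rw [coeff_two_mul, h0, h1, h0', h1']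
    linear_combination h2 + h2'

theorem HasChern.inv {A : Type} [CommRing A] {u : A⟦X⟧ˣ} {x y : A}
    (hu : HasChern (u : A⟦X⟧) x y) : HasChern ((u⁻¹ : A⟦X⟧ˣ) : A⟦X⟧) (-x) (-y) := by
  obtain ⟨h0, h1, h2⟩ := hu
  have e0 := coeff_zero_mul (u : A⟦X⟧) ((u⁻¹ : A⟦X⟧ˣ) : A⟦X⟧)
  have e1 := coeff_one_mul (u : A⟦X⟧) ((u⁻¹ : A⟦X⟧ˣ) : A⟦X⟧)
  have e2 := coeff_two_mul (u : A⟦X⟧) ((u⁻¹ : A⟦X⟧ˣ) : A⟦X⟧)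
  simp only [Units.mul_inv, PowerSeries.coeff_one, h0, h1, one_mul, if_true, one_ne_zero,
    OfNat.ofNat_ne_zero, if_false] at e0 e1 e2
  rw [← e0, mul_one] at e1 e2
  have e1' : PowerSeries.coeff 1 ((u⁻¹ : A⟦X⟧ˣ) : A⟦X⟧) = -x := by linear_combination -e1
  rw [e1'] at e2
  exact ⟨e0.symm, e1', by linear_combination -2 * e2 - h2⟩

theorem HasChern.zpow {A : Type} [CommRing A] {u : A⟦X⟧ˣ} {x y : A}
    (hu : HasChern (u : A⟦X⟧) x y) (a : ℤ) :
    HasChern ((u ^ a : A⟦X⟧ˣ) : A⟦X⟧) (a • x) (a • y) := by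
  induction a using Int.induction_on with
  | zero => simpa using HasChern.one
  | succ i ih =>
    rw [zpow_add_one, Units.val_mul, add_smul, add_smul, one_smul, one_smul]
    exact ih.mul hu
  | pred i ih =>
    rw [zpow_sub_one, Units.val_mul, sub_smul, sub_smul, one_smul, one_smul, sub_eq_add_neg,
      sub_eq_add_neg]
    exact ih.mul hu.inv

theorem HasChern.prod {A κ : Type} [CommRing A] {u : κ → A⟦X⟧ˣ} {x y : κ → A} (s : Finset κ)
    (hu : ∀ i, HasChern (u i : A⟦X⟧) (x i) (y i)) :
    HasChern ((∏ i ∈ s, u i : A⟦X⟧ˣ) : A⟦X⟧) (∑ i ∈ s, x i) (∑ i ∈ s, y i) := by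
  classical
  induction s using Finset.induction_on with
  | empty => simpa using HasChern.one
  | insert i s hi ih =>
    rw [Finset.prod_insert hi, Finset.sum_insert hi, Finset.sum_insert hi, Units.val_mul]
    exact (hu i).mul ih

theorem hasChern_oneSubUnit {A : Type} [CommRing A] (a : A) :
    HasChern (oneSubUnit a : A⟦X⟧) (-a) (-a ^ 2) := by
  have h : (oneSubUnit a : A⟦X⟧) = 1 - PowerSeries.C a * PowerSeries.X := rfl
  rw [h]
  simp [HasChern, PowerSeries.coeff_one]

/-- What matters about the second invariant is that it is linear in the weight; it therefore
disappears on Weyl invariants. -/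
theorem hasChern_totalChern {m n : ℕ} (x : Tsc m n) :
    HasChern (totalChern m n (Multiplicative.ofAdd x)) (ι ℤ (Tsc m n) x)
      (∑ i, (tscBasis m n).repr x i • ι ℤ (Tsc m n) (tscBasis m n i) ^ 2) := by
  have h := HasChern.prod Finset.univ fun i =>
    (hasChern_oneSubUnit (ι ℤ (Tsc m n) (tscBasis m n i))).zpow (-((tscBasis m n).repr x i))
  simp only [smul_neg, neg_smul, neg_neg] at h
  have hx : ∑ i, (tscBasis m n).repr x i • ι ℤ (Tsc m n) (tscBasis m n i) = ι ℤ (Tsc m n) x := by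
    conv_rhs => rw [← (tscBasis m n).sum_repr x]
    simp only [map_sum, map_smul]
  rw [hx] at h
  exact h

/-- The sum `∑ a_λ g(λ)` attached to `f = ∑ a_λ e^λ`. -/
def weightSum {m n : ℕ} {B : Type} [AddCommGroup B] (f : AddMonoidAlgebra ℤ (Tsc m n)) :
    (Tsc m n → B) →+ B where
  toFun g := f.coeff.sum fun x c => c • g x
  map_zero' := by simp
  map_add' g h := by simp [Finsupp.sum_add]

theorem weightSum_apply {m n : ℕ} {B : Type} [AddCommGroup B] (f : AddMonoidAlgebra ℤ (Tsc m n))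
    (g : Tsc m n → B) : weightSum f g = f.coeff.sum fun x c => c • g x := rfl

theorem map_weightSum {m n : ℕ} {B C : Type} [AddCommGroup B] [AddCommGroup C]
    (f : AddMonoidAlgebra ℤ (Tsc m n)) (g : Tsc m n → B) (l : B →+ C) :
    l (weightSum f g) = weightSum f fun x => l (g x) := by
  simp [weightSum_apply, Finsupp.sum, map_sum, map_zsmul]

theorem weightSum_congr {m n : ℕ} {B : Type} [AddCommGroup B] {f : AddMonoidAlgebra ℤ (Tsc m n)}
    {L : AddSubgroup (Tsc m n)} (hf : ∀ x, x ∉ L → f.coeff x = 0) {g h : Tsc m n → B}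
    (hgh : ∀ x ∈ L, g x = h x) : weightSum f g = weightSum f h := by
  refine Finset.sum_congr rfl fun x hx => ?_
  simp only
  rw [hgh x]
  by_contra hxL
  exact Finsupp.mem_support_iff.1 hx (hf x hxL)

theorem weightSum_comp {m n : ℕ} {B : Type} [AddCommGroup B] {f : AddMonoidAlgebra ℤ (Tsc m n)}
    {w : Equiv.Perm (Fin m) × Equiv.Perm (Fin n)}
    (hf : AddMonoidAlgebra.mapDomain (weylAct m n w) f = f) (g : Tsc m n → B) :
    weightSum f (fun x => g (weylAct m n w x)) = weightSum f g := by
  conv_rhs => rw [← hf]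
  rw [weightSum_apply, weightSum_apply, AddMonoidAlgebra.coeff_mapDomain,
    Finsupp.sum_mapDomain_index (by simp) (by simp [add_smul])]

theorem weightSum_sum_single {m n : ℕ} {B κ : Type} [AddCommGroup B] (s : Finset κ)
    (x : κ → Tsc m n) (g : Tsc m n → B) :
    weightSum (∑ i ∈ s, AddMonoidAlgebra.single (x i) (1 : ℤ)) g = ∑ i ∈ s, g (x i) := by
  classical
  induction s using Finset.induction_on with
  | empty => simp [weightSum_apply]
  | insert i s hi ih =>
    rw [Finset.sum_insert hi, Finset.sum_insert hi, ← ih, weightSum_apply,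
      AddMonoidAlgebra.coeff_add, Finsupp.sum_add_index' (by simp) (by simp [add_smul])]
    simp [weightSum_apply]

theorem c2_eq_weightSum {m n : ℕ} (f : AddMonoidAlgebra ℤ (Tsc m n)) :
    c2 m n f = weightSum f fun x =>
      PowerSeries.coeff 2 (totalChern m n (Multiplicative.ofAdd x)) := by
  have h : c2 m n f = PowerSeries.coeff 2
      (AddMonoidAlgebra.lift ℤ ((Sym m n)⟦X⟧) (Tsc m n) (totalChern m n) f) := rfl
  rw [h, AddMonoidAlgebra.lift_apply]
  exact map_weightSum f (fun x => totalChern m n (Multiplicative.ofAdd x))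
    (PowerSeries.coeff (R := Sym m n) 2).toAddMonoidHom

theorem weightSum_id_eq_zero {m n : ℕ} {f : AddMonoidAlgebra ℤ (Tsc m n)}
    (hf : ∀ w, AddMonoidAlgebra.mapDomain (weylAct m n w) f = f) :
    weightSum f (fun x => x) = 0 := by
  have h : ∀ w, weylAct m n w (weightSum f fun x => x) = weightSum f fun x => x := fun w =>
    (map_weightSum f (fun x => x) (weylAct m n w).toAddMonoidHom).trans
      (weightSum_comp (hf w) fun x => x)
  ext1
  · exact eq_zero_of_permAct_eq fun σ => congrArg Prod.fst (h (σ, 1))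
  · exact eq_zero_of_permAct_eq fun σ => congrArg Prod.snd (h (1, σ))

/-- The correction term is a linear function of `∑ a_λ λ`, a Weyl-fixed weight and hence zero. -/
theorem two_mul_c2 {m n : ℕ} {f : AddMonoidAlgebra ℤ (Tsc m n)}
    (hf : ∀ w, AddMonoidAlgebra.mapDomain (weylAct m n w) f = f) :
    2 * c2 m n f = weightSum f fun x => ι ℤ (Tsc m n) x ^ 2 := by
  rw [c2_eq_weightSum]
  have h := map_weightSum f (fun x => PowerSeries.coeff 2
    (totalChern m n (Multiplicative.ofAdd x))) (AddMonoidHom.mulLeft (2 : Sym m n))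
  simp only [AddMonoidHom.coe_mulLeft, (hasChern_totalChern _).2.2] at h
  rw [h, ← Pi.add_def, map_add, add_eq_left]
  have h2 := map_weightSum f (fun x => x) ((LinearMap.toAddMonoidHom
    (∑ i, ((tscBasis m n).coord i).smulRight (ι ℤ (Tsc m n) (tscBasis m n i) ^ 2))))
  rw [weightSum_id_eq_zero hf, map_zero] at h2
  rw [h2]
  simp [LinearMap.sum_apply]

/-- The coordinates of the first component of a weight. -/
def coordLeft (m n : ℕ) (i : Fin m) (x : Tsc m n) : ℤ := weightRep m x.1 i

/-- The coordinates of the second component of a weight. -/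
def coordRight (m n : ℕ) (j : Fin n) (x : Tsc m n) : ℤ := weightRep n x.2 j

theorem coordLeft_weylAct {m n : ℕ} (w : Equiv.Perm (Fin m) × Equiv.Perm (Fin n)) (i : Fin m)
    (x : Tsc m n) : coordLeft m n i (weylAct m n w x) = coordLeft m n (w.1⁻¹ i) x :=
  weightRep_permAct w.1 x.1 i

theorem coordRight_weylAct {m n : ℕ} (w : Equiv.Perm (Fin m) × Equiv.Perm (Fin n)) (j : Fin n)
    (x : Tsc m n) : coordRight m n j (weylAct m n w x) = coordRight m n (w.2⁻¹ j) x :=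
  weightRep_permAct w.2 x.2 j

theorem ι_mul_ι {m n : ℕ} (x y : Tsc m n) :
    ι ℤ (Tsc m n) x * ι ℤ (Tsc m n) y =
      ∑ i, ∑ j, (coordLeft m n i x * coordLeft m n j y) • (stdLeft m n i * stdLeft m n j)
      + ∑ i, ∑ j, (coordLeft m n i x * coordRight m n j y) • (stdLeft m n i * stdRight m n j)
      + ∑ i, ∑ j, (coordLeft m n i y * coordRight m n j x) • (stdLeft m n i * stdRight m n j)
      + ∑ i, ∑ j, (coordRight m n i x * coordRight m n j y) •
          (stdRight m n i * stdRight m n j) := by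
  have e : ∀ {κ κ' : Type} [Fintype κ] [Fintype κ'] (a : κ → ℤ) (b : κ' → ℤ) (u : κ → Sym m n)
      (v : κ' → Sym m n), ∑ i, ∑ j, (a i * b j) • (u i * v j)
        = (∑ i, a i • u i) * ∑ j, b j • v j := by
    intro κ κ' _ _ a b u v
    simp only [Finset.sum_mul_sum, smul_mul_smul_comm]
  rw [ι_eq_sum x, ι_eq_sum y]
  simp only [e]
  change (∑ i, coordLeft m n i x • stdLeft m n i + ∑ j, coordRight m n j x • stdRight m n j)
    * (∑ i, coordLeft m n i y • stdLeft m n i + ∑ j, coordRight m n j y • stdRight m n j) = _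
  ring

theorem weightSum_sum_smul {m n : ℕ} {B κ κ' : Type} [AddCommGroup B] [Fintype κ] [Fintype κ']
    (f : AddMonoidAlgebra ℤ (Tsc m n)) (a : κ → κ' → Tsc m n → ℤ) (u : κ → κ' → B) :
    weightSum f (fun x => ∑ i, ∑ j, a i j x • u i j) =
      ∑ i, ∑ j, weightSum f (a i j) • u i j := by
  have h : (fun x => ∑ i, ∑ j, a i j x • u i j) = ∑ i, ∑ j, fun x => a i j x • u i j := by
    ext x
    simp [Finset.sum_apply]
  rw [h]
  simp only [map_sum]
  refine Finset.sum_congr rfl fun i _ => Finset.sum_congr rfl fun j _ => ?_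
  exact (map_weightSum f (a i j) ((smulAddHom ℤ B).flip (u i j))).symm

/-! ### Second moments of the coordinates of an invariant element -/

section Invariant

variable {m n : ℕ} {f : AddMonoidAlgebra ℤ (Tsc m n)}

theorem weightSum_coordLeft_mul (hf : ∀ w, AddMonoidAlgebra.mapDomain (weylAct m n w) f = f)
    (σ : Equiv.Perm (Fin m)) (i j : Fin m) :
    weightSum f (fun x => coordLeft m n (σ i) x * coordLeft m n (σ j) x) =
      weightSum f (fun x => coordLeft m n i x * coordLeft m n j x) := by
  rw [← weightSum_comp (hf (σ, 1)) (fun x => coordLeft m n (σ i) x * coordLeft m n (σ j) x)]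
  simp [coordLeft_weylAct]

theorem weightSum_coordRight_mul (hf : ∀ w, AddMonoidAlgebra.mapDomain (weylAct m n w) f = f)
    (σ : Equiv.Perm (Fin n)) (i j : Fin n) :
    weightSum f (fun x => coordRight m n (σ i) x * coordRight m n (σ j) x) =
      weightSum f (fun x => coordRight m n i x * coordRight m n j x) := by
  rw [← weightSum_comp (hf (1, σ)) (fun x => coordRight m n (σ i) x * coordRight m n (σ j) x)]
  simp [coordRight_weylAct]

theorem weightSum_coordLeft_mul_coordRight
    (hf : ∀ w, AddMonoidAlgebra.mapDomain (weylAct m n w) f = f)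
    (σ : Equiv.Perm (Fin m)) (τ : Equiv.Perm (Fin n)) (i : Fin m) (j : Fin n) :
    weightSum f (fun x => coordLeft m n (σ i) x * coordRight m n (τ j) x) =
      weightSum f (fun x => coordLeft m n i x * coordRight m n j x) := by
  rw [← weightSum_comp (hf (σ, τ)) (fun x => coordLeft m n (σ i) x * coordRight m n (τ j) x)]
  simp [coordLeft_weylAct, coordRight_weylAct]

/-- The moment matrices are permutation invariant, so `sum_invariant_quadratic` applies to each
factor. The mixed moments drop out because `∑ e_i = 0`. -/
theorem c2_eq (hm : 2 ≤ m) (hn : 2 ≤ n)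
    (hf : ∀ w, AddMonoidAlgebra.mapDomain (weylAct m n w) f = f)
    {a b : Fin m} (hab : a ≠ b) {a' b' : Fin n} (hab' : a' ≠ b') :
    c2 m n f =
      (weightSum f (fun x => coordLeft m n a x * coordLeft m n a x)
        - weightSum f (fun x => coordLeft m n a x * coordLeft m n b x)) • q m n
      + (weightSum f (fun x => coordRight m n a' x * coordRight m n a' x)
        - weightSum f (fun x => coordRight m n a' x * coordRight m n b' x)) • q' m n := by
  apply two_mul_cancel
  rw [two_mul_c2 hf, mul_add, mul_smul_comm, mul_smul_comm, two_mul_q n hm, two_mul_q' m hn,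
    ← sum_invariant_quadratic (stdLeft m n) (sum_stdLeft m n)
      (fun i j => weightSum f fun x => coordLeft m n i x * coordLeft m n j x)
      (weightSum_coordLeft_mul hf) hab,
    ← sum_invariant_quadratic (stdRight m n) (sum_stdRight m n)
      (fun i j => weightSum f fun x => coordRight m n i x * coordRight m n j x)
      (weightSum_coordRight_mul hf) hab']
  simp only [sq, ι_mul_ι]
  simp only [← Pi.add_def, map_add]
  rw [weightSum_sum_smul, weightSum_sum_smul, weightSum_sum_smul,
    sum_invariant_bilinear (stdLeft m n) (stdRight m n) (sum_stdLeft m n)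
      (fun i j => weightSum f fun x => coordLeft m n i x * coordRight m n j x)
      fun σ i j => weightSum_coordLeft_mul_coordRight hf σ 1 i j, add_zero, add_zero]

/-- Against an invariant weight function `u`, all `m` coordinates have the same moment. -/
theorem natCast_mul_weightSum_coordLeft
    (hf : ∀ w, AddMonoidAlgebra.mapDomain (weylAct m n w) f = f) {u : Tsc m n → ℤ}
    (hu : ∀ w x, u (weylAct m n w x) = u x) (a : Fin m) :
    (m : ℤ) * weightSum f (fun x => u x * coordLeft m n a x) =
      weightSum f fun x => u x * ∑ i, coordLeft m n i x := by
  have h : (fun x => u x * ∑ i, coordLeft m n i x) = ∑ i, fun x => u x * coordLeft m n i x := by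
    ext x
    simp [Finset.sum_apply, Finset.mul_sum]
  rw [h, map_sum, Finset.sum_congr rfl fun i _ => ?_, Finset.sum_const, Finset.card_univ,
    Fintype.card_fin, nsmul_eq_mul]
  rw [← weightSum_comp (hf (Equiv.swap i a, 1)) (fun x => u x * coordLeft m n i x)]
  simp [hu, coordLeft_weylAct]

theorem natCast_mul_weightSum_coordRight
    (hf : ∀ w, AddMonoidAlgebra.mapDomain (weylAct m n w) f = f) {u : Tsc m n → ℤ}
    (hu : ∀ w x, u (weylAct m n w x) = u x) (a : Fin n) :
    (n : ℤ) * weightSum f (fun x => u x * coordRight m n a x) =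
      weightSum f fun x => u x * ∑ i, coordRight m n i x := by
  have h : (fun x => u x * ∑ i, coordRight m n i x) =
      ∑ i, fun x => u x * coordRight m n i x := by
    ext x
    simp [Finset.sum_apply, Finset.mul_sum]
  rw [h, map_sum, Finset.sum_congr rfl fun i _ => ?_, Finset.sum_const, Finset.card_univ,
    Fintype.card_fin, nsmul_eq_mul]
  rw [← weightSum_comp (hf (1, Equiv.swap i a)) (fun x => u x * coordRight m n i x)]
  simp [hu, coordRight_weylAct]

theorem weightSum_coordLeft_mul_sum
    (hf : ∀ w, AddMonoidAlgebra.mapDomain (weylAct m n w) f = f) {a b : Fin m} (hab : a ≠ b) :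
    weightSum f (fun x => coordLeft m n a x * ∑ i, coordLeft m n i x) =
      weightSum f (fun x => coordLeft m n a x * coordLeft m n a x) +
        ((m : ℤ) - 1) * weightSum f (fun x => coordLeft m n a x * coordLeft m n b x) := by
  have h : (fun x => coordLeft m n a x * ∑ i, coordLeft m n i x) =
      (fun x => coordLeft m n a x * coordLeft m n a x) +
        ∑ i ∈ Finset.univ.erase a, fun x => coordLeft m n a x * coordLeft m n i x := by
    ext x
    rw [Pi.add_apply, Finset.sum_apply, ← Finset.mul_sum, ← mul_add,
      Finset.add_sum_erase _ (fun i => coordLeft m n i x) (Finset.mem_univ a)]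
  rw [h, map_add, map_sum, Finset.sum_congr rfl fun i hi => ?_, Finset.sum_const,
    Finset.card_erase_of_mem (Finset.mem_univ a), Finset.card_univ, Fintype.card_fin,
    nsmul_eq_mul, Nat.cast_sub a.pos, Nat.cast_one]
  obtain ⟨σ, h1, h2⟩ := exists_perm_apply_eq (Finset.ne_of_mem_erase hi).symm hab
  rw [← weightSum_coordLeft_mul hf σ a i, h1, h2]

theorem weightSum_coordRight_mul_sum
    (hf : ∀ w, AddMonoidAlgebra.mapDomain (weylAct m n w) f = f) {a b : Fin n} (hab : a ≠ b) :
    weightSum f (fun x => coordRight m n a x * ∑ i, coordRight m n i x) =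
      weightSum f (fun x => coordRight m n a x * coordRight m n a x) +
        ((n : ℤ) - 1) * weightSum f (fun x => coordRight m n a x * coordRight m n b x) := by
  have h : (fun x => coordRight m n a x * ∑ i, coordRight m n i x) =
      (fun x => coordRight m n a x * coordRight m n a x) +
        ∑ i ∈ Finset.univ.erase a, fun x => coordRight m n a x * coordRight m n i x := by
    ext x
    rw [Pi.add_apply, Finset.sum_apply, ← Finset.mul_sum, ← mul_add,
      Finset.add_sum_erase _ (fun i => coordRight m n i x) (Finset.mem_univ a)]
  rw [h, map_add, map_sum, Finset.sum_congr rfl fun i hi => ?_, Finset.sum_const,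
    Finset.card_erase_of_mem (Finset.mem_univ a), Finset.card_univ, Fintype.card_fin,
    nsmul_eq_mul, Nat.cast_sub a.pos, Nat.cast_one]
  obtain ⟨σ, h1, h2⟩ := exists_perm_apply_eq (Finset.ne_of_mem_erase hi).symm hab
  rw [← weightSum_coordRight_mul hf σ a i, h1, h2]

theorem weightSum_coordLeft_mul_sum_coordRight
    (hf : ∀ w, AddMonoidAlgebra.mapDomain (weylAct m n w) f = f) (a : Fin m) (b : Fin n) :
    weightSum f (fun x => coordLeft m n a x * ∑ j, coordRight m n j x) =
      (n : ℤ) * weightSum f (fun x => coordLeft m n a x * coordRight m n b x) := by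
  have h : (fun x => coordLeft m n a x * ∑ j, coordRight m n j x) =
      ∑ j, fun x => coordLeft m n a x * coordRight m n j x := by
    ext x
    simp [Finset.sum_apply, Finset.mul_sum]
  rw [h, map_sum, Finset.sum_congr rfl fun j _ => ?_, Finset.sum_const, Finset.card_univ,
    Fintype.card_fin, nsmul_eq_mul]
  rw [← weightSum_coordLeft_mul_coordRight hf 1 (Equiv.swap j b) a j, Equiv.swap_apply_left]
  rfl

theorem weightSum_coordRight_mul_sum_coordLeft
    (hf : ∀ w, AddMonoidAlgebra.mapDomain (weylAct m n w) f = f) (a : Fin m) (b : Fin n) :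
    weightSum f (fun x => coordRight m n b x * ∑ i, coordLeft m n i x) =
      (m : ℤ) * weightSum f (fun x => coordLeft m n a x * coordRight m n b x) := by
  have h : (fun x => coordRight m n b x * ∑ i, coordLeft m n i x) =
      ∑ i, fun x => coordLeft m n i x * coordRight m n b x := by
    ext x
    simp [Finset.sum_apply, Finset.mul_sum, mul_comm]
  rw [h, map_sum, Finset.sum_congr rfl fun i _ => ?_, Finset.sum_const, Finset.card_univ,
    Fintype.card_fin, nsmul_eq_mul]
  rw [← weightSum_coordLeft_mul_coordRight hf (Equiv.swap i a) 1 i b, Equiv.swap_apply_left]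
  rfl

theorem weightSum_modEq_two {L : AddSubgroup (Tsc m n)} (hf : ∀ x, x ∉ L → f.coeff x = 0)
    {g h : Tsc m n → ℤ} (hgh : ∀ x ∈ L, Even (g x - h x)) :
    Even (weightSum f g - weightSum f h) := by
  rw [← map_sub, weightSum_congr hf (h := fun x => 2 * ((g x - h x) / 2)) ?_]
  · rw [even_iff_two_dvd]
    exact ⟨_, (map_weightSum f (fun x => (g x - h x) / 2) (AddMonoidHom.mulLeft 2)).symm⟩
  · intro x hx
    exact (Int.two_mul_ediv_two_of_even (hgh x hx)).symm

end Invariant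

/-! ### Upper bound for `Dec` -/

/-- The sum of all coordinates of the representative of a weight. -/
def coordSum (m n : ℕ) (x : Tsc m n) : ℤ := ∑ i, coordLeft m n i x + ∑ j, coordRight m n j x

theorem coordSum_weylAct {m n : ℕ} (w : Equiv.Perm (Fin m) × Equiv.Perm (Fin n)) (x : Tsc m n) :
    coordSum m n (weylAct m n w x) = coordSum m n x := by
  simp only [coordSum, coordLeft_weylAct, coordRight_weylAct]
  rw [Equiv.sum_comp w.1⁻¹ fun i => coordLeft m n i x,
    Equiv.sum_comp w.2⁻¹ fun j => coordRight m n j x]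

theorem dvd_coordSum {k m n : ℕ} {hm : k ∣ m} {hn : k ∣ n} {x : Tsc m n}
    (hx : x ∈ charLattice hm hn) : (k : ℤ) ∣ coordSum m n x := by
  rw [mem_charLattice, ← mk_weightRep x.1, ← mk_weightRep x.2, classMap_mk, classMap_mk,
    ← Int.cast_add, ZMod.intCast_zmod_eq_zero_iff_dvd] at hx
  exact hx

theorem isCoprime_sub_one {k m : ℤ} (h : k ∣ m) : IsCoprime k (m - 1) := by
  obtain ⟨y, rfl⟩ := h
  exact ⟨y, -1, by ring⟩

/-- The divisibility constraints satisfied by `c_2` of an invariant element. -/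
theorem exists_of_mem_Dec {k m n : ℕ} (hk : k ≠ 0) (hm2 : 2 ≤ m) (hn2 : 2 ≤ n) {hm : k ∣ m}
    {hn : k ∣ n} {y y' : ℕ} (hy : m = k * y) (hy' : n = k * y') {φ : Sym m n}
    (hφ : φ ∈ Dec hm hn) :
    ∃ e e' : ℤ, φ = (k * e) • q m n + (k * e') • q' m n ∧
      (Even k → Even (y * e + y' * e')) := by
  obtain ⟨f, ⟨hfL, hf⟩, rfl⟩ := hφ
  have hab : (⟨0, by omega⟩ : Fin m) ≠ ⟨1, by omega⟩ := by simp
  have hab' : (⟨0, by omega⟩ : Fin n) ≠ ⟨1, by omega⟩ := by simp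
  generalize (⟨0, _⟩ : Fin m) = a at hab
  generalize (⟨1, _⟩ : Fin m) = b at hab
  generalize (⟨0, _⟩ : Fin n) = a' at hab'
  generalize (⟨1, _⟩ : Fin n) = b' at hab'
  have hk0 : (k : ℤ) ≠ 0 := by exact_mod_cast hk
  set z : Tsc m n → ℤ := fun x => coordSum m n x / k with hz
  have hzk : ∀ x ∈ charLattice hm hn, coordSum m n x = k * z x := fun x hx =>
    (Int.mul_ediv_cancel' (dvd_coordSum hx)).symm
  have hzw : ∀ w x, z (weylAct m n w x) = z x := fun w x => by
    simp only [hz, coordSum_weylAct]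
  have hmul : ∀ (g : Tsc m n → ℤ), weightSum f (fun x => g x * coordSum m n x) =
      k * weightSum f (fun x => z x * g x) := by
    intro g
    rw [weightSum_congr hfL (h := fun x => k * (z x * g x))]
    · exact (map_weightSum f (fun x => z x * g x) (AddMonoidHom.mulLeft (k : ℤ))).symm
    · intro x hx
      rw [hzk x hx]
      ring
  -- Once rewritten, this reads `k S = A + (m - 1) B + n G`, where `G` is the mixed moment and `S`
  -- the moment of `z` against coordinate `a`.
  have hL : weightSum f (fun x => coordLeft m n a x * coordSum m n x) =
      weightSum f (fun x => coordLeft m n a x * ∑ i, coordLeft m n i x) +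
      weightSum f (fun x => coordLeft m n a x * ∑ i, coordRight m n i x) := by
    rw [← map_add]
    simp only [coordSum, mul_add, Pi.add_def]
  have hR : weightSum f (fun x => coordRight m n a' x * coordSum m n x) =
      weightSum f (fun x => coordRight m n a' x * ∑ i, coordLeft m n i x) +
      weightSum f (fun x => coordRight m n a' x * ∑ i, coordRight m n i x) := by
    rw [← map_add]
    simp only [coordSum, mul_add, Pi.add_def]
  rw [hmul, weightSum_coordLeft_mul_sum hf hab,
    weightSum_coordLeft_mul_sum_coordRight hf a a'] at hL
  rw [hmul, weightSum_coordRight_mul_sum hf hab',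
    weightSum_coordRight_mul_sum_coordLeft hf a a'] at hR
  -- The factor `1 + z` is chosen so that the left side becomes `k ∑ a_λ z(1 + z)`, whose sum is
  -- even.
  have hZ : weightSum f (fun x => (1 + z x) * coordSum m n x) =
      weightSum f (fun x => (1 + z x) * ∑ i, coordLeft m n i x) +
      weightSum f (fun x => (1 + z x) * ∑ i, coordRight m n i x) := by
    rw [← map_add]
    simp only [coordSum, mul_add, Pi.add_def]
  rw [hmul, ← natCast_mul_weightSum_coordLeft hf (fun w x => by rw [hzw]) a,
    ← natCast_mul_weightSum_coordRight hf (fun w x => by rw [hzw]) a'] at hZ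
  have hZ2 : Even (weightSum f (fun x => z x * (1 + z x)) - weightSum f fun _ => (0 : ℤ)) :=
    weightSum_modEq_two hfL fun x _ => by
      rw [sub_zero, add_comm]
      exact Int.even_mul_succ_self (z x)
  have hL1 : weightSum f (fun x => (1 + z x) * coordLeft m n a x) =
      weightSum f (coordLeft m n a) + weightSum f (fun x => z x * coordLeft m n a x) := by
    rw [← map_add]
    simp only [add_mul, one_mul, Pi.add_def]
  have hR1 : weightSum f (fun x => (1 + z x) * coordRight m n a' x) =
      weightSum f (coordRight m n a') + weightSum f (fun x => z x * coordRight m n a' x) := by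
    rw [← map_add]
    simp only [add_mul, one_mul, Pi.add_def]
  have hL2 : Even (weightSum f (fun x => coordLeft m n a x * coordLeft m n a x) -
      weightSum f (coordLeft m n a)) :=
    weightSum_modEq_two hfL fun x _ => by
      rw [← sub_one_mul, mul_comm]
      exact Int.even_mul_pred_self _
  have hR2 : Even (weightSum f (fun x => coordRight m n a' x * coordRight m n a' x) -
      weightSum f (coordRight m n a')) :=
    weightSum_modEq_two hfL fun x _ => by
      rw [← sub_one_mul, mul_comm]
      exact Int.even_mul_pred_self _
  have h0 : weightSum f (fun _ => (0 : ℤ)) = 0 := map_zero (weightSum f)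
  rw [h0, sub_zero] at hZ2
  rw [hL1, hR1] at hZ
  rw [c2_eq hm2 hn2 hf hab hab']
  generalize weightSum f (fun x => coordLeft m n a x * coordLeft m n a x) = A at *
  generalize weightSum f (fun x => coordLeft m n a x * coordLeft m n b x) = B at *
  generalize weightSum f (fun x => coordRight m n a' x * coordRight m n a' x) = A' at *
  generalize weightSum f (fun x => coordRight m n a' x * coordRight m n b' x) = B' at *
  generalize weightSum f (fun x => coordLeft m n a x * coordRight m n a' x) = G at *
  generalize weightSum f (fun x => z x * coordLeft m n a x) = S at *
  generalize weightSum f (fun x => z x * coordRight m n a' x) = S' at *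
  generalize weightSum f (coordLeft m n a) = T at *
  generalize weightSum f (coordRight m n a') = T' at *
  generalize weightSum f (fun x => z x * (1 + z x)) = Z at *
  have hmy : (m : ℤ) = k * y := by exact_mod_cast hy
  have hny : (n : ℤ) = k * y' := by exact_mod_cast hy'
  -- Eliminate `B`: `(m - 1)(A - B) = m A - (A + (m - 1) B)`. Since `k ∣ m`, the factor `m - 1` is
  -- prime to `k`.
  have key : ((m : ℤ) - 1) * (A - B) = k * (y * A - S + y' * G) := by
    rw [hmy, hny] at hL
    rw [hmy]
    linear_combination hL
  have key' : ((n : ℤ) - 1) * (A' - B') = k * (y' * A' - S' + y * G) := by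
    rw [hmy, hny] at hR
    rw [hny]
    linear_combination hR
  obtain ⟨e, he⟩ : (k : ℤ) ∣ A - B :=
    (isCoprime_sub_one (Int.natCast_dvd_natCast.2 hm)).dvd_of_dvd_mul_left ⟨_, key⟩
  obtain ⟨e', he'⟩ : (k : ℤ) ∣ A' - B' :=
    (isCoprime_sub_one (Int.natCast_dvd_natCast.2 hn)).dvd_of_dvd_mul_left ⟨_, key'⟩
  refine ⟨e, e', by rw [he, he'], fun hkeven => ?_⟩
  have ke : ((m : ℤ) - 1) * e = y * A - S + y' * G := by
    apply mul_left_cancel₀ hk0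
    rw [← key, he]
    ring
  have ke' : ((n : ℤ) - 1) * e' = y' * A' - S' + y * G := by
    apply mul_left_cancel₀ hk0
    rw [← key', he']
    ring
  have kZ : Z = y * (T + S) + y' * (T' + S') := by
    apply mul_left_cancel₀ hk0
    rw [hZ, hmy, hny]
    ring
  rw [hmy] at ke
  rw [hny] at ke'
  obtain ⟨l, hl⟩ := hkeven
  obtain ⟨t, ht⟩ := hL2
  obtain ⟨t', ht'⟩ := hR2
  obtain ⟨s, hs⟩ := hZ2
  obtain ⟨v, hv⟩ := Int.even_mul_pred_self (y : ℤ)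
  obtain ⟨v', hv'⟩ := Int.even_mul_pred_self (y' : ℤ)
  rw [hl] at ke ke'
  push_cast at ke ke'
  -- Modulo 2, `e ≡ y A + S + y' G` and `e' ≡ y' A' + S' + y G`. With `y² ≡ y`, `A ≡ T` and `A' ≡
  -- T'`, the `G` terms cancel and `y e + y' e' ≡ y(T + S) + y'(T' + S') = Z`, which is even. The
  -- witness is half of the exact difference.
  refine ⟨y * (l * y * e) + y' * (l * y' * e') - y * y * t - v * T - y' * y' * t' - v' * T'
    - y * y' * G - s + y * S + y' * S', ?_⟩
  rw [kZ] at hs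
  obtain rfl : A = T + (t + t) := by linarith
  obtain rfl : A' = T' + (t' + t') := by linarith
  linear_combination -y * ke - y' * ke' + hs * (-1) - T * hv - T' * hv'

/-! ### Evaluation at cocharacters -/

/-- The linear form `[v] ↦ ∑ c_i v_i` on the weight lattice. -/
def weightFunctional {m : ℕ} (c : Fin m → ℤ) (hc : ∑ i, c i = 0) : WeightLattice m →ₗ[ℤ] ℤ :=
  Submodule.liftQ _ (∑ i, c i • LinearMap.proj i) (by
    rw [Submodule.span_singleton_le_iff_mem, LinearMap.mem_ker]
    simpa [LinearMap.sum_apply] using hc)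

theorem weightFunctional_mk {m : ℕ} (c : Fin m → ℤ) (hc : ∑ i, c i = 0) (v : Fin m → ℤ) :
    weightFunctional c hc (Submodule.Quotient.mk v) = ∑ i, c i * v i := by
  rw [weightFunctional, Submodule.liftQ_apply]
  simp [LinearMap.sum_apply]

theorem weightFunctional_stdWeight {m : ℕ} (c : Fin m → ℤ) (hc : ∑ i, c i = 0) (i : Fin m) :
    weightFunctional c hc (stdWeight m i) = c i := by
  rw [stdWeight, weightFunctional_mk]
  simp [Pi.single_apply]

/-- Evaluation of a polynomial function at a cocharacter. -/
def evalSym {m n : ℕ} (x : Tsc m n →ₗ[ℤ] ℤ) : Sym m n →ₐ[ℤ] ℤ := SymmetricAlgebra.lift x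

theorem evalSym_ι {m n : ℕ} (x : Tsc m n →ₗ[ℤ] ℤ) (y : Tsc m n) :
    evalSym x (ι ℤ _ y) = x y := SymmetricAlgebra.lift_ι_apply _ _

theorem two_mul_evalSym_q {m : ℕ} (n : ℕ) (hm : 2 ≤ m) (c : Fin m → ℤ) (hc : ∑ i, c i = 0)
    (x : WeightLattice n →ₗ[ℤ] ℤ) :
    2 * evalSym ((weightFunctional c hc).coprod x) (q m n) = ∑ i, c i ^ 2 := by
  have h := congrArg (evalSym ((weightFunctional c hc).coprod x)) (two_mul_q n hm)
  rw [map_mul, map_ofNat, map_sum] at h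
  simpa only [map_pow, stdLeft, evalSym_ι, LinearMap.coprod_apply, map_zero, add_zero,
    weightFunctional_stdWeight] using h

theorem two_mul_evalSym_q' (m : ℕ) {n : ℕ} (hn : 2 ≤ n) (c : Fin n → ℤ) (hc : ∑ i, c i = 0)
    (x : WeightLattice m →ₗ[ℤ] ℤ) :
    2 * evalSym (x.coprod (weightFunctional c hc)) (q' m n) = ∑ i, c i ^ 2 := by
  have h := congrArg (evalSym (x.coprod (weightFunctional c hc))) (two_mul_q' m hn)
  rw [map_mul, map_ofNat, map_sum] at h
  simpa only [map_pow, stdRight, evalSym_ι, LinearMap.coprod_apply, map_zero, zero_add,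
    weightFunctional_stdWeight] using h

theorem exists_coroot {m : ℕ} (hm : 2 ≤ m) :
    ∃ c : Fin m → ℤ, ∑ i, c i = 0 ∧ ∑ i, c i ^ 2 = 2 := by
  obtain ⟨r, rfl⟩ : ∃ r, m = r + 2 := ⟨m - 2, by omega⟩
  refine ⟨Fin.cons 1 (Fin.cons (-1) 0), ?_, ?_⟩ <;> simp [Fin.sum_univ_succ]

/-- The values of `q` and `q'` at the simple coroots of the two factors. -/
theorem exists_evalSym {m n : ℕ} (hm : 2 ≤ m) (hn : 2 ≤ n) :
    (∃ x : Tsc m n →ₗ[ℤ] ℤ, evalSym x (q m n) = 1 ∧ evalSym x (q' m n) = 0) ∧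
      ∃ x : Tsc m n →ₗ[ℤ] ℤ, evalSym x (q m n) = 0 ∧ evalSym x (q' m n) = 1 := by
  have e0 : ∀ (l : ℕ), weightFunctional (0 : Fin l → ℤ) (by simp) = 0 := by
    intro l
    ext i
    simp [weightFunctional]
  constructor
  · obtain ⟨c, hc, hc2⟩ := exists_coroot hm
    refine ⟨(weightFunctional c hc).coprod (weightFunctional 0 (by simp)), ?_, ?_⟩
    · have := two_mul_evalSym_q n hm c hc (weightFunctional 0 (by simp))
      omega
    · have := two_mul_evalSym_q' m hn 0 (by simp) (weightFunctional c hc)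
      simpa using this
  · obtain ⟨c, hc, hc2⟩ := exists_coroot hn
    refine ⟨(weightFunctional 0 (by simp)).coprod (weightFunctional c hc), ?_, ?_⟩
    · have := two_mul_evalSym_q n hm 0 (by simp) (weightFunctional c hc)
      simpa using this
    · have := two_mul_evalSym_q' m hn c hc (weightFunctional 0 (by simp))
      omega

theorem eq_zero_of_smul_q_add {m n : ℕ} (hm : 2 ≤ m) (hn : 2 ≤ n) {s t : ℤ}
    (h : s • q m n + t • q' m n = 0) : s = 0 ∧ t = 0 := by
  obtain ⟨⟨x, hx, hx'⟩, y, hy, hy'⟩ := exists_evalSym hm hn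
  have h1 := congrArg (evalSym x) h
  have h2 := congrArg (evalSym y) h
  simp only [map_add, map_smul, map_zero, hx, hx', hy, hy', smul_eq_mul] at h1 h2
  constructor <;> linarith

/-! ### Elements of `Dec` -/

/-- The formal character `∑ e^{x_i}` is invariant and supported on `T^*`. Repeated weights are
allowed, so convenient index sets can be used. -/
theorem mem_Dec_of_sum_sq {k m n : ℕ} {hm : k ∣ m} {hn : k ∣ n} {κ : Type} [Fintype κ]
    (x : κ → Tsc m n) (hx : ∀ i, x i ∈ charLattice hm hn)
    (hW : ∀ w, ∃ e : κ ≃ κ, ∀ i, weylAct m n w (x i) = x (e i)) {φ : Sym m n}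
    (hφ : ∑ i, ι ℤ (Tsc m n) (x i) ^ 2 = 2 * φ) : φ ∈ Dec hm hn := by
  have hinv : ∀ w, AddMonoidAlgebra.mapDomain (weylAct m n w)
      (∑ i, AddMonoidAlgebra.single (x i) (1 : ℤ)) = ∑ i, AddMonoidAlgebra.single (x i) 1 := by
    intro w
    obtain ⟨e, he⟩ := hW w
    have h := map_sum (⟨⟨AddMonoidAlgebra.mapDomain (weylAct m n w),
      AddMonoidAlgebra.mapDomain_zero _⟩, AddMonoidAlgebra.mapDomain_add _⟩ :
        AddMonoidAlgebra ℤ (Tsc m n) →+ AddMonoidAlgebra ℤ (Tsc m n))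
      (fun i => AddMonoidAlgebra.single (x i) (1 : ℤ)) Finset.univ
    simp only [AddMonoidHom.coe_mk, ZeroHom.coe_mk, AddMonoidAlgebra.mapDomain_single, he] at h
    rw [h]
    exact Equiv.sum_comp e fun i => AddMonoidAlgebra.single (x i) (1 : ℤ)
  refine ⟨∑ i, AddMonoidAlgebra.single (x i) 1, ⟨fun y hy => ?_, hinv⟩, ?_⟩
  · classical
    rw [AddMonoidAlgebra.coeff_sum, Finsupp.finsetSum_apply]
    refine Finset.sum_eq_zero fun i _ => ?_
    rw [AddMonoidAlgebra.coeff_single, Finsupp.single_apply, if_neg]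
    rintro rfl
    exact hy (hx i)
  · apply two_mul_cancel
    rw [two_mul_c2 hinv, weightSum_sum_single, hφ]

/-- `c` is the Dynkin index of a Weyl-stable family of weights of `SL_m` that are trivial
on `μ_k`. -/
def IsIndex {k m : ℕ} (hm : k ∣ m) (c : ℤ) : Prop :=
  ∃ (κ : Type) (_ : Fintype κ) (x : κ → WeightLattice m), (∀ i, classMap hm (x i) = 0) ∧
    (∀ σ, ∃ e : κ ≃ κ, ∀ i, permAct m σ (x i) = x (e i)) ∧
    ∀ (A : Type) [CommRing A] (g : WeightLattice m →ₗ[ℤ] A),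
      ∑ i, g (x i) ^ 2 = c • ∑ i, g (stdWeight m i) ^ 2

theorem IsIndex.smul_q_mem {k m n : ℕ} (hm2 : 2 ≤ m) {hm : k ∣ m} {c : ℤ}
    (h : IsIndex hm c) (hn : k ∣ n) : c • q m n ∈ Dec hm hn := by
  obtain ⟨κ, _, x, hx, hW, hs⟩ := h
  refine mem_Dec_of_sum_sq (fun i => (x i, 0)) (fun i => ?_) (fun w => ?_) ?_
  · rw [mem_charLattice, hx, map_zero, add_zero]
  · obtain ⟨e, he⟩ := hW w.1
    exact ⟨e, fun i => by rw [weylAct_apply, he, map_zero]⟩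
  · rw [mul_smul_comm, two_mul_q n hm2]
    exact hs _ (ι ℤ (Tsc m n) ∘ₗ LinearMap.inl ℤ _ _)

theorem IsIndex.smul_q'_mem {k m n : ℕ} (hn2 : 2 ≤ n) (hm : k ∣ m) {hn : k ∣ n} {c : ℤ}
    (h : IsIndex hn c) : c • q' m n ∈ Dec hm hn := by
  obtain ⟨κ, _, x, hx, hW, hs⟩ := h
  refine mem_Dec_of_sum_sq (fun i => (0, x i)) (fun i => ?_) (fun w => ?_) ?_
  · rw [mem_charLattice, hx, map_zero, add_zero]
  · obtain ⟨e, he⟩ := hW w.2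
    exact ⟨e, fun i => by rw [weylAct_apply, he, map_zero]⟩
  · rw [mul_smul_comm, two_mul_q' m hn2]
    exact hs _ (ι ℤ (Tsc m n) ∘ₗ LinearMap.inr ℤ _ _)

theorem isIndex_sq {k m : ℕ} (hm : k ∣ m) : IsIndex hm ((k : ℤ) ^ 2) := by
  refine ⟨Fin m, inferInstance, fun i => (k : ℤ) • stdWeight m i, fun i => ?_, fun σ => ⟨σ,
    fun i => ?_⟩, fun A _ g => ?_⟩
  · rw [map_smul, classMap_stdWeight]
    simp
  · rw [map_smul, permAct_stdWeight]
  · rw [Finset.smul_sum]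
    refine Finset.sum_congr rfl fun i _ => ?_
    rw [map_smul, smul_pow]

/-- These are the roots together with `m` harmless zero weights from the diagonal pairs. The cross
terms vanish by `∑ e_i = 0`. -/
theorem isIndex_two_mul {k m : ℕ} (hm : k ∣ m) : IsIndex hm (2 * (m : ℤ)) := by
  refine ⟨Fin m × Fin m, inferInstance, fun i => stdWeight m i.1 - stdWeight m i.2, fun i => ?_,
    fun σ => ⟨Equiv.prodCongr σ σ, fun i => ?_⟩, fun A _ g => ?_⟩
  · rw [map_sub, classMap_stdWeight, classMap_stdWeight, sub_self]
  · rw [map_sub, permAct_stdWeight, permAct_stdWeight]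
    rfl
  · have h0 : ∑ i, g (stdWeight m i) = 0 := by rw [← map_sum, sum_stdWeight, map_zero]
    rw [Fintype.sum_prod_type]
    simp only [map_sub, sub_sq, Finset.sum_add_distrib, Finset.sum_sub_distrib, ← Finset.mul_sum,
      h0, Finset.sum_const, Finset.card_univ, Fintype.card_fin, nsmul_eq_mul, mul_zero, sub_zero,
      zsmul_eq_mul]
    push_cast
    ring

/-- The family consists of the weights of the `k`-th exterior power, one for each `k`-subset. The
factor `m - 1` makes a second binomial coefficient unnecessary. -/
theorem exists_isIndex_choose {k m : ℕ} (hk : k ≠ 0) (hm2 : 2 ≤ m) (hm : k ∣ m) :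
    ∃ c : ℤ, IsIndex hm c ∧ ((m : ℤ) - 1) * c = (m - k) * (m - 1).choose (k - 1) := by
  let κ : Type := {s : Finset (Fin m) // s.card = k}
  let u : κ → Fin m → ℤ := fun s i => if i ∈ s.1 then 1 else 0
  let M : Fin m → Fin m → ℤ := fun i j => ∑ s, u s i * u s j
  let e : Equiv.Perm (Fin m) → (κ ≃ κ) := fun σ =>
    σ.finsetCongr.subtypeEquiv fun s => by simp
  have hu : ∀ σ s i, u (e σ s) (σ i) = u s i := by
    intro σ s i
    have h : σ i ∈ (e σ s).1 ↔ i ∈ s.1 := Finset.mem_map' σ.toEmbedding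
    simp only [u, h]
  have hM : ∀ (σ : Equiv.Perm (Fin m)) i j, M (σ i) (σ j) = M i j := by
    intro σ i j
    simp only [M]
    rw [← Equiv.sum_comp (e σ)]
    simp only [hu]
  have hab : (⟨0, by omega⟩ : Fin m) ≠ ⟨1, by omega⟩ := by simp
  generalize (⟨0, _⟩ : Fin m) = a at hab
  generalize (⟨1, _⟩ : Fin m) = b at hab
  have hcard : ∀ s, ∑ i, u s i = k := by
    intro s
    simp [u, s.2]
  have huu : ∀ s i, u s i * u s i = u s i := by
    intro s i
    simp only [u]
    split_ifs <;> rfl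
  -- Row `a` of `M` counts pairs of an element and a `k`-subset containing both it and `a`.
  have hrow : M a a + ((m : ℤ) - 1) * M a b = k * M a a := by
    have h1 : ∑ j, M a j = k * M a a := by
      simp only [M]
      rw [Finset.sum_comm]
      simp only [← Finset.mul_sum, hcard, huu, ← Finset.sum_mul]
      ring
    have h2 : ∀ j ∈ Finset.univ.erase a, M a j = M a b := by
      intro j hj
      obtain ⟨σ, e1, e2⟩ := exists_perm_apply_eq (Finset.ne_of_mem_erase hj).symm hab
      rw [← hM σ a j, e1, e2]
    rw [← Finset.add_sum_erase _ _ (Finset.mem_univ a), Finset.sum_congr rfl h2,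
      Finset.sum_const, Finset.card_erase_of_mem (Finset.mem_univ a), Finset.card_univ,
      Fintype.card_fin, nsmul_eq_mul, Nat.cast_sub (by omega), Nat.cast_one] at h1
    exact h1
  have hdiag : M a a = (m - 1).choose (k - 1) := by
    have h1 : (m : ℤ) * M a a = k * m.choose k := by
      have h2 : ∀ i ∈ Finset.univ, M i i = M a a := fun i _ => by
        rw [← hM (Equiv.swap i a) i i, Equiv.swap_apply_left]
      have h3 : ∑ i, M i i = (m : ℤ) * M a a := by
        rw [Finset.sum_congr rfl h2]
        simp
      rw [← h3]
      simp only [M, huu]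
      rw [Finset.sum_comm]
      simp only [hcard, Finset.sum_const, Finset.card_univ, κ, Fintype.card_finset_len,
        Fintype.card_fin, nsmul_eq_mul]
      ring
    have h4 : (m : ℤ) * (m - 1).choose (k - 1) = m.choose k * k := by
      have h5 := Nat.add_one_mul_choose_eq (m - 1) (k - 1)
      rw [Nat.sub_add_cancel (by omega),
        Nat.sub_add_cancel (by omega)] at h5
      exact_mod_cast h5
    have hm0 : (m : ℤ) ≠ 0 := by omega
    apply mul_left_cancel₀ hm0
    rw [h1, h4, mul_comm]
  refine ⟨M a a - M a b, ⟨κ, inferInstance, fun s => ∑ i, u s i • stdWeight m i, fun s => ?_,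
    fun σ => ⟨e σ, fun s => ?_⟩, fun A _ g => ?_⟩, ?_⟩
  · simp only [map_sum, map_smul, classMap_stdWeight]
    rw [← Finset.sum_smul, hcard]
    simp
  · simp only [map_sum, map_smul, permAct_stdWeight]
    rw [← Equiv.sum_comp σ (fun i => u (e σ s) i • stdWeight m i)]
    simp only [hu]
  · have h0 : ∑ i, g (stdWeight m i) = 0 := by rw [← map_sum, sum_stdWeight, map_zero]
    rw [← sum_invariant_quadratic (fun i => g (stdWeight m i)) h0 M hM hab]
    have hs : ∀ s : κ, g (∑ i, u s i • stdWeight m i) ^ 2 =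
        ∑ i, ∑ j, (u s i * u s j) • (g (stdWeight m i) * g (stdWeight m j)) := by
      intro s
      simp only [map_sum, map_smul, sq, Finset.sum_mul_sum, smul_mul_smul_comm]
    simp only [hs, M, Finset.sum_smul]
    rw [Finset.sum_comm]
    refine Finset.sum_congr rfl fun i _ => Finset.sum_comm
  · rw [← hdiag]
    linear_combination -hrow

/-- Use the weights of the tensor product of one standard representation with the dual of the other;
the diagonal `μ_k` acts trivially on it. -/
theorem smul_q_add_smul_q'_mem {k m n : ℕ} (hm2 : 2 ≤ m) (hn2 : 2 ≤ n) (hm : k ∣ m)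
    (hn : k ∣ n) : (n : ℤ) • q m n + (m : ℤ) • q' m n ∈ Dec hm hn := by
  refine mem_Dec_of_sum_sq (κ := Fin m × Fin n) (fun i => (stdWeight m i.1, -stdWeight n i.2))
    (fun i => ?_) (fun w => ⟨Equiv.prodCongr w.1 w.2, fun i => ?_⟩) ?_
  · rw [mem_charLattice, map_neg, classMap_stdWeight, classMap_stdWeight, add_neg_cancel]
  · rw [weylAct_apply, map_neg, permAct_stdWeight, permAct_stdWeight]
    rfl
  · have h : ∀ i : Fin m × Fin n, ι ℤ (Tsc m n) (stdWeight m i.1, -stdWeight n i.2) =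
        stdLeft m n i.1 - stdRight m n i.2 := by
      intro i
      rw [stdLeft, stdRight, ← map_sub]
      simp
    simp only [h]
    rw [Fintype.sum_prod_type, mul_add, mul_smul_comm, mul_smul_comm, two_mul_q n hm2,
      two_mul_q' m hn2]
    simp only [sub_sq, Finset.sum_add_distrib, Finset.sum_sub_distrib, ← Finset.mul_sum,
      sum_stdRight, Finset.sum_const, Finset.card_univ, Fintype.card_fin, mul_zero, sub_zero,
      natCast_zsmul, ← Finset.smul_sum]

/-- The lowest `r` base-`p` digits of both `p^r y - 1` and `p^r - 1` are all `p - 1`, so every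
factor in Lucas's formula is 1. -/
theorem choose_modEq_one {p : ℕ} (hp : p.Prime) (r y : ℕ) (hy : 0 < y) :
    (p ^ r * y - 1).choose (p ^ r - 1) ≡ 1 [ZMOD p] := by
  have : Fact p.Prime := ⟨hp⟩
  have hpos := pow_pos hp.pos r
  have hdig : ∀ t, 0 < t → ∀ i ∈ Finset.range r, (p ^ r * t - 1) / p ^ i % p = p - 1 := by
    intro t ht i hi
    rw [Finset.mem_range] at hi
    obtain ⟨s, rfl⟩ : ∃ s, r = i + 1 + s := ⟨r - (i + 1), by omega⟩
    obtain ⟨v, hv⟩ : ∃ v, p ^ s * t = v + 1 :=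
      ⟨p ^ s * t - 1, (Nat.sub_add_cancel (Nat.mul_pos (pow_pos hp.pos s) ht)).symm⟩
    have h1 : p ^ (i + 1 + s) * t = p ^ i * (p * (v + 1)) := by
      rw [← hv]
      ring
    have hp2 := hp.two_le
    have h2 : p ^ i * (p * (v + 1)) - 1 = (p ^ i - 1) + p ^ i * (p * v + (p - 1)) := by
      have hi := pow_pos hp.pos i
      obtain ⟨l, hl⟩ : ∃ l, p = l + 1 := ⟨p - 1, by omega⟩
      have h3 : p ^ i * (p * (v + 1)) = p ^ i + p ^ i * (p * v + (p - 1)) := by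
        rw [hl, Nat.add_sub_cancel]
        ring
      omega
    have hi := pow_pos hp.pos i
    rw [h1, h2, Nat.add_mul_div_left _ _ hi, Nat.div_eq_of_lt (by omega), zero_add,
      Nat.mul_add_mod, Nat.mod_eq_of_lt (by omega)]
  refine (Choose.choose_modEq_choose_mul_prod_range_choose r).trans ?_
  rw [Nat.div_eq_of_lt (show p ^ r - 1 < p ^ r by omega), Nat.choose_zero_right,
    Finset.prod_eq_one]
  · simp
  · intro i hi
    have h1 := hdig 1 one_pos i hi
    rw [mul_one] at h1
    rw [hdig y hy i hi, h1, Nat.choose_self]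

/-! ### Bezout arguments on the multiples of `q` and `q'` -/

section Prime

variable {p r k m n y : ℕ} {B : Type} [AddCommGroup B] {D : AddSubgroup B} {b : B}

theorem smul_mem_of_isCoprime {u : ℤ} (h1 : ((k : ℤ) ^ 2) • b ∈ D) {c : ℤ}
    (h2 : (c * k * u) • b ∈ D) (hu : IsCoprime u k) : (c * k) • b ∈ D := by
  obtain ⟨s, t, hst⟩ := hu
  have h : (c * k) • b = s • ((c * k * u) • b) + (c * t) • (((k : ℤ) ^ 2) • b) := by
    rw [smul_smul, smul_smul, ← add_smul]
    congr 1
    linear_combination -(c * k) * hst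
  rw [h]
  exact D.add_mem (D.zsmul_mem h2 s) (D.zsmul_mem h1 _)

theorem isCoprime_of_not_dvd (hp : p.Prime) (hk : k = p ^ r) {u : ℤ} (hu : ¬ (p : ℤ) ∣ u) :
    IsCoprime u k := by
  rw [hk, Nat.cast_pow]
  exact (((Nat.prime_iff_prime_int.1 hp).coprime_iff_not_dvd).2 hu).symm.pow_right

/-- The exterior power gives the multiple `k (y - 1) C(m-1, k-1)`. When `p ∣ y` the cofactor of `k`
is prime to `p`, and `k²` is also available. Keeping `b` and `D` abstract serves both `q` and `q'`.
-/
theorem smul_mem_of_dvd (hp : p.Prime) (hk : k = p ^ r) (hm2 : 2 ≤ m) {hm : k ∣ m}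
    (hy : m = k * y) (hpy : p ∣ y) (hD : ∀ c, IsIndex hm c → c • b ∈ D) : (k : ℤ) • b ∈ D := by
  have hk0 : k ≠ 0 := by
    rw [hk]
    exact (pow_pos hp.pos r).ne'
  have hy0 : 0 < y := by
    rcases Nat.eq_zero_or_pos y with rfl | h
    · omega
    · exact h
  obtain ⟨c, hc, hc2⟩ := exists_isIndex_choose hk0 hm2 hm
  have hp' := Nat.prime_iff_prime_int.1 hp
  have h := smul_mem_of_isCoprime (c := 1) (u := ((y : ℤ) - 1) * (m - 1).choose (k - 1))
    (hD _ (isIndex_sq hm)) ?_ (isCoprime_of_not_dvd hp hk ?_)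
  · rwa [one_mul] at h
  · have h2 : (1 : ℤ) * k * (((y : ℤ) - 1) * (m - 1).choose (k - 1)) = (m - 1) * c := by
      rw [hc2, hy, Nat.cast_mul]
      ring
    rw [h2, mul_smul]
    exact D.zsmul_mem (hD c hc) _
  · intro hdvd
    rcases hp'.dvd_or_dvd hdvd with h1 | h1
    · have h2 := dvd_sub (Int.natCast_dvd_natCast.2 hpy) h1
      rw [sub_sub_cancel] at h2
      exact hp'.not_dvd_one h2
    · have h2 := choose_modEq_one hp r y hy0
      rw [← hk, ← hy] at h2
      exact hp'.not_dvd_one (h2.dvd_iff.1 h1)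

theorem smul_mem_of_ne_two (hp : p.Prime) (hp2 : p ≠ 2) (hk : k = p ^ r) (hm2 : 2 ≤ m)
    {hm : k ∣ m} (hy : m = k * y) (hD : ∀ c, IsIndex hm c → c • b ∈ D) : (k : ℤ) • b ∈ D := by
  by_cases hpy : p ∣ y
  · exact smul_mem_of_dvd hp hk hm2 hy hpy hD
  · have h := smul_mem_of_isCoprime (c := 1) (u := 2 * y)
      (hD _ (isIndex_sq hm)) ?_ (isCoprime_of_not_dvd hp hk ?_)
    · rwa [one_mul] at h
    · have h2 : (1 : ℤ) * k * (2 * y) = 2 * m := by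
        rw [hy, Nat.cast_mul]
        ring
      rw [h2]
      exact hD _ (isIndex_two_mul hm)
    · intro hdvd
      have h1 : p ∣ 2 * y := by exact_mod_cast hdvd
      rcases hp.dvd_mul.1 h1 with h3 | h3
      · exact hp2 ((Nat.prime_dvd_prime_iff_eq hp Nat.prime_two).1 h3)
      · exact hpy h3

theorem two_mul_smul_mem (hp : p.Prime) (hk : k = p ^ r) {hm : k ∣ m} (hy : m = k * y)
    (hpy : ¬ p ∣ y) (hD : ∀ c, IsIndex hm c → c • b ∈ D) : (2 * k : ℤ) • b ∈ D := by
  refine smul_mem_of_isCoprime (u := y) (hD _ (isIndex_sq hm)) ?_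
    (isCoprime_of_not_dvd hp hk (by exact_mod_cast hpy))
  have h2 : (2 : ℤ) * k * y = 2 * m := by
    rw [hy, Nat.cast_mul]
    ring
  rw [h2]
  exact hD _ (isIndex_two_mul hm)

end Prime

/-! ### The group `Q` -/

theorem weylAct_mul {m n : ℕ} (w w' : Equiv.Perm (Fin m) × Equiv.Perm (Fin n)) (x : Tsc m n) :
    weylAct m n (w * w') x = weylAct m n w (weylAct m n w' x) := by
  simp [weylAct_apply, permAct_mul]

/-- The average over the Weyl group of an element of `S^2` is a combination of the two normalized
Killing forms. -/
theorem exists_sum_weylSym {m n : ℕ} (hm : 2 ≤ m) (hn : 2 ≤ n) {L : AddSubgroup (Tsc m n)}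
    {φ : Sym m n} (hφ : φ ∈ symSq L) :
    ∃ c c' : ℤ, ∑ w, weylSym m n w φ = c • (2 * q m n) + c' • (2 * q' m n) := by
  induction hφ using AddSubgroup.closure_induction with
  | mem φ h =>
    obtain ⟨x, -, y, -, rfl⟩ := h
    have hsum : ∀ (F : Tsc m n → Tsc m n → ℤ) (τ : Equiv.Perm (Fin m) × Equiv.Perm (Fin n)),
        ∑ w, F (weylAct m n τ (weylAct m n w x)) (weylAct m n τ (weylAct m n w y)) =
          ∑ w, F (weylAct m n w x) (weylAct m n w y) := by
      intro F τ
      simp only [← weylAct_mul]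
      exact Equiv.sum_comp (Equiv.mulLeft τ) fun w => F (weylAct m n w x) (weylAct m n w y)
    have hab : (⟨0, by omega⟩ : Fin m) ≠ ⟨1, by omega⟩ := by simp
    have hab' : (⟨0, by omega⟩ : Fin n) ≠ ⟨1, by omega⟩ := by simp
    have h1 := sum_invariant_quadratic (stdLeft m n) (sum_stdLeft m n)
      (fun i j => ∑ w, coordLeft m n i (weylAct m n w x) * coordLeft m n j (weylAct m n w y))
      (fun σ i j => by
        rw [← hsum (fun x y => coordLeft m n (σ i) x * coordLeft m n (σ j) y) (σ, 1)]
        simp [coordLeft_weylAct]) hab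
    have h2 := sum_invariant_quadratic (stdRight m n) (sum_stdRight m n)
      (fun i j => ∑ w, coordRight m n i (weylAct m n w x) * coordRight m n j (weylAct m n w y))
      (fun σ i j => by
        rw [← hsum (fun x y => coordRight m n (σ i) x * coordRight m n (σ j) y) (1, σ)]
        simp [coordRight_weylAct]) hab'
    have h3 := sum_invariant_bilinear (stdLeft m n) (stdRight m n) (sum_stdLeft m n)
      (fun i j => ∑ w, coordLeft m n i (weylAct m n w x) * coordRight m n j (weylAct m n w y))
      (fun σ i j => by
        rw [← hsum (fun x y => coordLeft m n (σ i) x * coordRight m n j y) (σ, 1)]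
        simp [coordLeft_weylAct, coordRight_weylAct])
    have h4 := sum_invariant_bilinear (stdLeft m n) (stdRight m n) (sum_stdLeft m n)
      (fun i j => ∑ w, coordLeft m n i (weylAct m n w y) * coordRight m n j (weylAct m n w x))
      (fun σ i j => by
        rw [← hsum (fun x y => coordLeft m n (σ i) y * coordRight m n j x) (σ, 1)]
        simp [coordLeft_weylAct, coordRight_weylAct])
    rw [← two_mul_q n hm] at h1
    rw [← two_mul_q' m hn] at h2
    refine ⟨_, _, Eq.trans ?_ (congrArg₂ (· + ·) h1 h2)⟩
    have hswap : ∀ {κ κ' : Type} [Fintype κ] [Fintype κ'] (a : κ → Tsc m n → Tsc m n → ℤ)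
        (b : κ' → Tsc m n → Tsc m n → ℤ) (u : κ → κ' → Sym m n),
        ∑ w, ∑ i, ∑ j, (a i (weylAct m n w x) (weylAct m n w y) *
          b j (weylAct m n w x) (weylAct m n w y)) • u i j =
        ∑ i, ∑ j, (∑ w, a i (weylAct m n w x) (weylAct m n w y) *
          b j (weylAct m n w x) (weylAct m n w y)) • u i j := by
      intro κ κ' _ _ a b u
      rw [Finset.sum_comm]
      refine Finset.sum_congr rfl fun i _ => ?_
      rw [Finset.sum_comm]
      exact Finset.sum_congr rfl fun j _ => (Finset.sum_smul ..).symm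
    simp only [map_mul, weylSym_ι]
    simp only [ι_mul_ι, Finset.sum_add_distrib]
    rw [hswap (fun i x _ => coordLeft m n i x) (fun j _ y => coordLeft m n j y),
      hswap (fun i x _ => coordLeft m n i x) (fun j _ y => coordRight m n j y),
      hswap (fun i _ y => coordLeft m n i y) (fun j x _ => coordRight m n j x),
      hswap (fun i x _ => coordRight m n i x) (fun j _ y => coordRight m n j y),
      h3, h4, add_zero, add_zero]
  | zero => exact ⟨0, 0, by simp⟩
  | add a b _ _ ha hb =>
    obtain ⟨c, c', h⟩ := ha
    obtain ⟨d, d', h'⟩ := hb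
    refine ⟨c + d, c' + d', ?_⟩
    simp only [map_add, Finset.sum_add_distrib, h, h', add_smul]
    abel
  | neg a _ ha =>
    obtain ⟨c, c', h⟩ := ha
    refine ⟨-c, -c', ?_⟩
    simp only [map_neg, Finset.sum_neg_distrib, h, neg_smul]
    abel

/-- Averaging multiplies an invariant by `|W|`. The coefficients are then integral because they are
values at simple coroots, and `|W|` cancels. -/
theorem exists_of_mem_symSq_of_invariant {m n : ℕ} (hm : 2 ≤ m) (hn : 2 ≤ n)
    {L : AddSubgroup (Tsc m n)} {φ : Sym m n} (hφ : φ ∈ symSq L)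
    (hinv : φ ∈ symInvariants m n) : ∃ d d' : ℤ, φ = d • q m n + d' • q' m n := by
  obtain ⟨c, c', h⟩ := exists_sum_weylSym hm hn hφ
  obtain ⟨⟨x, hx, hx'⟩, y, hy, hy'⟩ := exists_evalSym hm hn
  have hinv' : ∀ w, weylSym m n w φ = φ := hinv
  simp only [hinv', Finset.sum_const, ← natCast_zsmul] at h
  set N : ℤ := ((Finset.univ : Finset (Equiv.Perm (Fin m) × Equiv.Perm (Fin n))).card : ℤ) with hN
  have hN0 : N ≠ 0 := by
    rw [hN, Nat.cast_ne_zero]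
    exact Finset.card_ne_zero_of_mem (Finset.mem_univ 1)
  refine ⟨evalSym x φ, evalSym y φ, zsmul_cancel hN0 ?_⟩
  have h1 := congrArg (evalSym x) h
  have h2 := congrArg (evalSym y) h
  simp only [map_add, map_smul, map_mul, map_ofNat, hx, hx', hy, hy', smul_eq_mul] at h1 h2
  rw [h, smul_add, smul_smul, smul_smul, h1, h2]
  simp only [zsmul_eq_mul]
  push_cast
  ring

theorem q_mem_symInvariants {m : ℕ} (n : ℕ) (hm : 2 ≤ m) : q m n ∈ symInvariants m n := by
  intro w
  apply two_mul_cancel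
  have h := congrArg (weylSym m n w) (two_mul_q n hm)
  rw [map_mul, map_ofNat, map_sum] at h
  rw [h, two_mul_q n hm, ← Equiv.sum_comp w.1 fun i => stdLeft m n i ^ 2]
  refine Finset.sum_congr rfl fun i _ => ?_
  rw [map_pow, stdLeft, weylSym_ι, weylAct_apply, permAct_stdWeight, map_zero, stdLeft]

theorem q'_mem_symInvariants (m : ℕ) {n : ℕ} (hn : 2 ≤ n) : q' m n ∈ symInvariants m n := by
  intro w
  apply two_mul_cancel
  have h := congrArg (weylSym m n w) (two_mul_q' m hn)
  rw [map_mul, map_ofNat, map_sum] at h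
  rw [h, two_mul_q' m hn, ← Equiv.sum_comp w.2 fun i => stdRight m n i ^ 2]
  refine Finset.sum_congr rfl fun i _ => ?_
  rw [map_pow, stdRight, weylSym_ι, weylAct_apply, permAct_stdWeight, map_zero, stdRight]

theorem mul_mem_symSq {m n : ℕ} {L : AddSubgroup (Tsc m n)} {x y : Tsc m n} (hx : x ∈ L)
    (hy : y ∈ L) : ι ℤ (Tsc m n) x * ι ℤ (Tsc m n) y ∈ symSq L :=
  AddSubgroup.subset_closure ⟨x, hx, y, hy, rfl⟩

theorem sq_dvd_evalSym {m n : ℕ} {L : AddSubgroup (Tsc m n)} {x : Tsc m n →ₗ[ℤ] ℤ} {k : ℤ}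
    (hx : ∀ y ∈ L, k ∣ x y) {φ : Sym m n} (hφ : φ ∈ symSq L) : k ^ 2 ∣ evalSym x φ := by
  induction hφ using AddSubgroup.closure_induction with
  | mem φ h =>
    obtain ⟨y, hy, z, hz, rfl⟩ := h
    rw [map_mul, evalSym_ι, evalSym_ι, sq]
    exact mul_dvd_mul (hx y hy) (hx z hz)
  | zero => simp
  | add a b _ _ ha hb =>
    rw [map_add]
    exact dvd_add ha hb
  | neg a _ ha =>
    rw [map_neg]
    exact (dvd_neg).2 ha

/-- The coefficients of the functional `v ↦ ∑ v_i - m v_a`. -/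
theorem sum_centralCoeff {m : ℕ} (a : Fin m) :
    ∑ i, ((1 : ℤ) - if i = a then (m : ℤ) else 0) = 0 ∧
      ∑ i, ((1 : ℤ) - if i = a then (m : ℤ) else 0) ^ 2 = m * (m - 1) := by
  constructor
  · simp [Finset.sum_sub_distrib]
  · have h : ∀ i, ((1 : ℤ) - if i = a then (m : ℤ) else 0) ^ 2 =
        1 + if i = a then (m : ℤ) ^ 2 - 2 * m else 0 := by
      intro i
      split_ifs <;> ring
    simp only [h, Finset.sum_add_distrib, Finset.sum_ite_eq', Finset.mem_univ, if_true,
      Finset.sum_const, Finset.card_univ, Fintype.card_fin, nsmul_eq_mul, mul_one]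
    ring

/-- The functional `∑ v_i - m v_a + ∑ v'_j - n v'_b` is divisible by `k` on `T^*`, and its values on
`2q` and `2q'` are `m(m-1)` and `n(n-1)`. -/
theorem dvd_of_mem_symSq {k m n : ℕ} (hm2 : 2 ≤ m) (hn2 : 2 ≤ n) {hm : k ∣ m} {hn : k ∣ n}
    {d d' : ℤ} (h : d • q m n + d' • q' m n ∈ symSq (charLattice hm hn)) :
    2 * (k : ℤ) ^ 2 ∣ d * (m * (m - 1)) + d' * (n * (n - 1)) := by
  obtain ⟨h1, h2⟩ := sum_centralCoeff (⟨0, by omega⟩ : Fin m)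
  obtain ⟨h1', h2'⟩ := sum_centralCoeff (⟨0, by omega⟩ : Fin n)
  set x := weightFunctional _ h1 with hx
  set x' := weightFunctional _ h1' with hx'
  have e : 2 * evalSym (x.coprod x') (q m n) = _ := two_mul_evalSym_q n hm2 _ h1 x'
  have e' : 2 * evalSym (x.coprod x') (q' m n) = _ := two_mul_evalSym_q' m hn2 _ h1' x
  rw [h2] at e
  rw [h2'] at e'
  have hdvd : ∀ y ∈ charLattice hm hn, (k : ℤ) ∣ x.coprod x' y := by
    rintro ⟨y, y'⟩ hy
    obtain ⟨v, rfl⟩ := Submodule.Quotient.mk_surjective _ y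
    obtain ⟨v', rfl⟩ := Submodule.Quotient.mk_surjective _ y'
    rw [mem_charLattice, classMap_mk, classMap_mk, ← Int.cast_add,
      ZMod.intCast_zmod_eq_zero_iff_dvd] at hy
    rw [LinearMap.coprod_apply, hx, hx', weightFunctional_mk, weightFunctional_mk]
    simp only [sub_mul, one_mul, Finset.sum_sub_distrib, ite_mul, zero_mul, Finset.sum_ite_eq',
      Finset.mem_univ, if_true]
    rw [sub_add_sub_comm]
    have hmz : (k : ℤ) ∣ m := Int.natCast_dvd_natCast.2 hm
    have hnz : (k : ℤ) ∣ n := Int.natCast_dvd_natCast.2 hn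
    exact dvd_sub hy (dvd_add (hmz.mul_right _) (hnz.mul_right _))
  obtain ⟨t, ht⟩ := sq_dvd_evalSym hdvd h
  simp only [map_add, map_smul, smul_eq_mul] at ht
  exact ⟨t, by rw [← e, ← e']; linear_combination 2 * ht⟩

theorem exists_sum_sq {m n : ℕ} {L : AddSubgroup (Tsc m n)} {κ : Type} (s : Finset κ)
    (x : κ → Tsc m n) (hx : ∀ i, x i ∈ L) :
    ∃ R ∈ symSq L, (∑ i ∈ s, ι ℤ (Tsc m n) (x i)) ^ 2 =
      ∑ i ∈ s, ι ℤ (Tsc m n) (x i) ^ 2 + 2 * R := by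
  classical
  induction s using Finset.induction_on with
  | empty => exact ⟨0, zero_mem _, by simp⟩
  | insert i s hi ih =>
    obtain ⟨R, hR, h⟩ := ih
    refine ⟨R + ι ℤ (Tsc m n) (x i) * ι ℤ (Tsc m n) (∑ j ∈ s, x j),
      add_mem hR (mul_mem_symSq (hx i) (sum_mem fun j _ => hx j)), ?_⟩
    rw [Finset.sum_insert hi, Finset.sum_insert hi, add_sq, h, map_sum]
    ring

/-- Expand the square of `∑ (x_i - x_a) = -l x_a`; its cross terms are twice an element of `S²(L)`.
-/
theorem two_mul_sum_sq {m n : ℕ} {L : AddSubgroup (Tsc m n)} {l : ℕ} (x : Fin l → Tsc m n)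
    (hx : ∑ i, x i = 0) (a : Fin l) (hL : ∀ i, x i - x a ∈ L) :
    ∃ R ∈ symSq L, ∑ i, ι ℤ (Tsc m n) (x i) ^ 2 =
      ((l : ℤ) * (l - 1)) • ι ℤ (Tsc m n) (x a) ^ 2 - 2 * R := by
  obtain ⟨R, hR, h⟩ := exists_sum_sq Finset.univ (fun i => x i - x a) hL
  refine ⟨R, hR, ?_⟩
  have h0 : ∑ i, ι ℤ (Tsc m n) (x i) = 0 := by rw [← map_sum, hx, map_zero]
  simp only [map_sub, sub_sq, Finset.sum_add_distrib, Finset.sum_sub_distrib, ← Finset.sum_mul,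
    ← Finset.mul_sum, h0, Finset.sum_const, Finset.card_univ, Fintype.card_fin,
    nsmul_eq_mul] at h
  rw [zsmul_eq_mul]
  push_cast
  linear_combination -h

theorem mem_symSq_of_dvd {k m n : ℕ} (hm2 : 2 ≤ m) (hn2 : 2 ≤ n) {hm : k ∣ m} {hn : k ∣ n}
    {d d' : ℤ} (h : 2 * (k : ℤ) ^ 2 ∣ d * (m * (m - 1)) + d' * (n * (n - 1))) :
    d • q m n + d' • q' m n ∈ symSq (charLattice hm hn) := by
  obtain ⟨t, ht⟩ := h
  obtain ⟨y, hy⟩ := hn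
  let a : Fin m := ⟨0, by omega⟩
  let b : Fin n := ⟨0, by omega⟩
  have hn : k ∣ n := ⟨y, hy⟩
  obtain ⟨R, hR, h1⟩ := two_mul_sum_sq (L := charLattice hm hn)
    (fun i => ((stdWeight m i, 0) : Tsc m n))
    (by
      have := congrArg (LinearMap.inl ℤ (WeightLattice m) (WeightLattice n)) (sum_stdWeight m)
      rwa [map_sum, map_zero] at this) a
    (fun i => by simp [mem_charLattice, classMap_stdWeight])
  obtain ⟨R', hR', h2⟩ := two_mul_sum_sq (L := charLattice hm hn)
    (fun i => ((0, stdWeight n i) : Tsc m n))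
    (by
      have := congrArg (LinearMap.inr ℤ (WeightLattice m) (WeightLattice n)) (sum_stdWeight n)
      rwa [map_sum, map_zero] at this) b
    (fun i => by simp [mem_charLattice, classMap_stdWeight])
  have h1' := (two_mul_q n hm2).trans h1
  have h2' := (two_mul_q' m hn2).trans h2
  have hku : (k : ℤ) • ((stdWeight m a, 0) : Tsc m n) ∈ charLattice hm hn := by
    rw [mem_charLattice]
    simp [classMap_stdWeight]
  have hδ : ((stdWeight m a, -stdWeight n b) : Tsc m n) ∈ charLattice hm hn := by
    simp [mem_charLattice, classMap_stdWeight]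
  have m1 := mul_mem_symSq hku hku
  have m2 := mul_mem_symSq hku hδ
  have m3 := mul_mem_symSq hδ hδ
  have hu' : ι ℤ (Tsc m n) (0, stdWeight n b) =
      ι ℤ (Tsc m n) (stdWeight m a, 0) - ι ℤ (Tsc m n) (stdWeight m a, -stdWeight n b) := by
    rw [← map_sub]
    simp
  obtain ⟨c, hc⟩ := Int.even_mul_pred_self (n : ℤ)
  rw [map_smul] at m1 m2
  rw [hu'] at h2'
  set u := ι ℤ (Tsc m n) (stdWeight m a, 0)
  set δ := ι ℤ (Tsc m n) (stdWeight m a, -stdWeight n b)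
  -- Substitute `e'_b = u - δ`. The `u²` terms combine to `2t k² u²`, the mixed term absorbs `n = k
  -- y` into `k u`, and the `δ²` term is halved because `n(n - 1)` is even.
  have key : d • q m n + d' • q' m n = t • ((k : ℤ) • u * (k : ℤ) • u)
      - (d' * (y * (n - 1))) • ((k : ℤ) • u * δ) + (d' * c) • (δ * δ) - d • R - d' • R' := by
    apply two_mul_cancel
    have ht' := congrArg (fun z : ℤ => (z : Sym m n)) ht
    have hc' := congrArg (fun z : ℤ => (z : Sym m n)) hc
    have hn' : (n : Sym m n) = k * y := by rw [← Nat.cast_mul, ← hy]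
    simp only [zsmul_eq_mul] at h1' h2' ⊢
    push_cast at ht' hc' h1' h2' ⊢
    linear_combination (d : Sym m n) * h1' + (d' : Sym m n) * h2' + u ^ 2 * ht'
      + (d' : Sym m n) * δ ^ 2 * hc' - 2 * (d' : Sym m n) * (n - 1) * u * δ * hn'
  rw [key]
  exact sub_mem (sub_mem (add_mem (sub_mem (zsmul_mem m1 _) (zsmul_mem m2 _)) (zsmul_mem m3 _))
    (zsmul_mem hR _)) (zsmul_mem hR' _)

/-- With `m = k y`, `m(m - 1) = k(k - 1) y + k² y(y - 1)`, and the last term is divisible by `2k²`.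
-/
theorem condition_iff {k y y' : ℕ} (hk : k ≠ 0) (d d' : ℤ) :
    (∃ t : ℤ, ((k : ℚ) - 1) / k * (((k * y : ℕ) : ℚ) * d + ((k * y' : ℕ) : ℚ) * d') = t * (2 * k))
      ↔ 2 * (k : ℤ) ^ 2 ∣ d * (((k * y : ℕ) : ℤ) * ((k * y : ℕ) - 1))
        + d' * (((k * y' : ℕ) : ℤ) * ((k * y' : ℕ) - 1)) := by
  have hkq : (k : ℚ) ≠ 0 := by exact_mod_cast hk
  have hkz : (k : ℤ) ≠ 0 := by exact_mod_cast hk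
  obtain ⟨v, hv⟩ := Int.even_mul_pred_self (y : ℤ)
  obtain ⟨v', hv'⟩ := Int.even_mul_pred_self (y' : ℤ)
  have h1 : ∀ t : ℤ, ((k : ℚ) - 1) / k * (((k * y : ℕ) : ℚ) * d + ((k * y' : ℕ) : ℚ) * d')
      = t * (2 * k) ↔ ((k : ℤ) - 1) * (y * d + y' * d') = t * (2 * k) := by
    intro t
    have e : ((k : ℚ) - 1) / k * (((k * y : ℕ) : ℚ) * d + ((k * y' : ℕ) : ℚ) * d') =
        ((k : ℚ) - 1) * (y * d + y' * d') := by
      push_cast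
      field_simp
    rw [e]
    exact_mod_cast Iff.rfl
  simp only [h1]
  push_cast
  constructor
  · rintro ⟨t, ht⟩
    exact ⟨t + v * d + v' * d', by
      linear_combination (k : ℤ) * ht + (k : ℤ) ^ 2 * d * hv + (k : ℤ) ^ 2 * d' * hv'⟩
  · rintro ⟨t, ht⟩
    refine ⟨t - v * d - v' * d', mul_left_cancel₀ hkz ?_⟩
    linear_combination ht - (k : ℤ) ^ 2 * d * hv - (k : ℤ) ^ 2 * d' * hv'

theorem coe_Q_eq {k m n : ℕ} (hk : k ≠ 0) (hm2 : 2 ≤ m) (hn2 : 2 ≤ n) (hm : k ∣ m) (hn : k ∣ n) :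
    (Q hm hn : Set (Sym m n)) = {φ | ∃ d d' : ℤ, φ = d • q m n + d' • q' m n ∧
      ∃ t : ℤ, ((k : ℚ) - 1) / k * (m * d + n * d') = t * (2 * k)} := by
  have hiff : ∀ d d' : ℤ, (∃ t : ℤ, ((k : ℚ) - 1) / k * (m * d + n * d') = t * (2 * k)) ↔
      2 * (k : ℤ) ^ 2 ∣ d * (m * (m - 1)) + d' * (n * (n - 1)) := by
    intro d d'
    obtain ⟨y, hy⟩ := id hm
    obtain ⟨y', hy'⟩ := id hn
    have := condition_iff (y := y) (y' := y') hk d d'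
    rwa [← hy, ← hy'] at this
  ext φ
  simp only [SetLike.mem_coe, Set.mem_ofPred_eq, hiff]
  constructor
  · rintro ⟨h1, h2⟩
    obtain ⟨d, d', rfl⟩ := exists_of_mem_symSq_of_invariant hm2 hn2 h1 h2
    exact ⟨d, d', rfl, dvd_of_mem_symSq hm2 hn2 h1⟩
  · rintro ⟨d, d', rfl, h⟩
    exact ⟨mem_symSq_of_dvd hm2 hn2 h, add_mem (zsmul_mem (q_mem_symInvariants n hm2) _)
      (zsmul_mem (q'_mem_symInvariants m hn2) _)⟩

/-! ### The group `Dec` -/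

theorem isDirectSumOf_of {k m n : ℕ} (hm2 : 2 ≤ m) (hn2 : 2 ≤ n) {hm : k ∣ m} {hn : k ∣ n}
    {a b a' b' : ℤ} (hdet : a * b' - b * a' ≠ 0)
    (h1 : a • q m n + a' • q' m n ∈ Dec hm hn) (h2 : b • q m n + b' • q' m n ∈ Dec hm hn)
    (h3 : ∀ φ ∈ Dec hm hn, ∃ s t : ℤ, φ = s • (a • q m n + a' • q' m n)
      + t • (b • q m n + b' • q' m n)) :
    IsDirectSumOf (Dec hm hn) (a • q m n + a' • q' m n) (b • q m n + b' • q' m n) := by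
  refine ⟨le_antisymm (fun φ hφ => ?_) (sup_le ?_ ?_), ?_⟩
  · obtain ⟨s, t, rfl⟩ := h3 φ hφ
    exact AddSubgroup.mem_sup.2 ⟨_, AddSubgroup.zsmul_mem_zmultiples _ s, _,
      AddSubgroup.zsmul_mem_zmultiples _ t, rfl⟩
  · exact AddSubgroup.zmultiples_le_of_mem h1
  · exact AddSubgroup.zmultiples_le_of_mem h2
  · rw [LinearIndependent.pair_iff]
    intro s t hst
    have h : (s * a + t * b) • q m n + (s * a' + t * b') • q' m n = 0 := by
      rw [← hst]
      simp only [zsmul_eq_mul]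
      push_cast
      ring
    obtain ⟨e, e'⟩ := eq_zero_of_smul_q_add hm2 hn2 h
    constructor
    · apply (mul_eq_zero.1 (_ : s * (a * b' - b * a') = 0)).resolve_right hdet
      linear_combination b' * e - b * e'
    · apply (mul_eq_zero.1 (_ : t * (a * b' - b * a') = 0)).resolve_right hdet
      linear_combination a * e' - a' * e

/-! ### The three shapes of `Dec` -/

section Prime

variable {p r k m n y y' : ℕ} {hm : k ∣ m} {hn : k ∣ n}

theorem isDirectSumOf_of_mem (hk : k ≠ 0) (hm2 : 2 ≤ m) (hn2 : 2 ≤ n)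
    (h1 : (k : ℤ) • q m n ∈ Dec hm hn) (h2 : (k : ℤ) • q' m n ∈ Dec hm hn) :
    IsDirectSumOf (Dec hm hn) (k • q m n) (k • q' m n) := by
  have hk0 : (k : ℤ) ≠ 0 := by exact_mod_cast hk
  have h := isDirectSumOf_of hm2 hn2 (hm := hm) (hn := hn) (a := k) (a' := 0) (b := 0) (b' := k)
    (by simpa using hk) (by simpa using h1) (by simpa using h2) fun φ hφ => ?_
  · simpa using h
  · obtain ⟨y, hy⟩ := id hm
    obtain ⟨y', hy'⟩ := id hn
    obtain ⟨e, e', rfl, -⟩ := exists_of_mem_Dec hk hm2 hn2 hy hy' hφ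
    refine ⟨e, e', ?_⟩
    simp only [zsmul_eq_mul]
    push_cast
    ring

theorem isDirectSumOf_of_odd (hr : 1 ≤ r) (hk : k = 2 ^ r) (hm2 : 2 ≤ m) (hn2 : 2 ≤ n)
    (hy : m = k * y) (hy' : n = k * y') (hodd : ¬ 2 ∣ y) (hodd' : ¬ 2 ∣ y') :
    IsDirectSumOf (Dec hm hn) (k • (q m n - q' m n)) (k • (q m n + q' m n)) := by
  have hk0 : k ≠ 0 := by
    rw [hk]
    positivity
  have hk0' : (k : ℤ) ≠ 0 := by exact_mod_cast hk0
  have m1 := two_mul_smul_mem Nat.prime_two hk hy hodd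
    (D := Dec hm hn) (b := q m n) fun c hc => hc.smul_q_mem hm2 hn
  have m2 := two_mul_smul_mem Nat.prime_two hk hy' hodd'
    (D := Dec hm hn) (b := q' m n) fun c hc => hc.smul_q'_mem hn2 hm
  have m3 := smul_q_add_smul_q'_mem hm2 hn2 hm hn
  obtain ⟨v, hv⟩ : ∃ v, y = 2 * v + 1 := ⟨y / 2, by omega⟩
  obtain ⟨v', hv'⟩ : ∃ v, y' = 2 * v + 1 := ⟨y' / 2, by omega⟩
  -- Both `y` and `y'` are odd, so `n q + m q'` agrees with `k q + k q'` modulo `2k q` and `2k q'`.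
  have m4 : (k : ℤ) • q m n + (k : ℤ) • q' m n ∈ Dec hm hn := by
    have h : (k : ℤ) • q m n + (k : ℤ) • q' m n = ((n : ℤ) • q m n + (m : ℤ) • q' m n)
        - (v' : ℤ) • ((2 * k : ℤ) • q m n) - (v : ℤ) • ((2 * k : ℤ) • q' m n) := by
      rw [hy, hy', hv, hv']
      simp only [zsmul_eq_mul]
      push_cast
      ring
    rw [h]
    exact sub_mem (sub_mem m3 (zsmul_mem m1 _)) (zsmul_mem m2 _)
  have m5 : (k : ℤ) • q m n + (-k : ℤ) • q' m n ∈ Dec hm hn := by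
    have h : (k : ℤ) • q m n + (-k : ℤ) • q' m n = ((k : ℤ) • q m n + (k : ℤ) • q' m n)
        - (2 * k : ℤ) • q' m n := by
      simp only [zsmul_eq_mul]
      push_cast
      ring
    rw [h]
    exact sub_mem m4 m2
  have hdet : (k : ℤ) * k - k * -k ≠ 0 := by
    rw [mul_neg, sub_neg_eq_add, ← two_mul]
    exact mul_ne_zero two_ne_zero (mul_ne_zero hk0' hk0')
  have h := isDirectSumOf_of hm2 hn2 hdet m5 m4 fun φ hφ => ?_
  · convert h using 1
    · rw [smul_sub, neg_smul, natCast_zsmul, natCast_zsmul, sub_eq_add_neg]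
    · rw [smul_add, natCast_zsmul, natCast_zsmul]
  · obtain ⟨e, e', rfl, h⟩ := exists_of_mem_Dec hk0 hm2 hn2 hy hy' hφ
    obtain ⟨s, hs⟩ := h (by rw [hk]; exact (even_two).pow_of_ne_zero (by omega))
    rw [hv, hv'] at hs
    push_cast at hs
    -- For odd `y, y'` the parity condition becomes `e + e'` even, which is integrality of the
    -- coordinates in `q - q'`, `q + q'`.
    obtain ⟨t, ht⟩ : ∃ t, e + e' = 2 * t := ⟨s - v * e - v' * e', by linear_combination hs⟩
    obtain rfl : e' = 2 * t - e := by linarith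
    refine ⟨e - t, t, ?_⟩
    simp only [zsmul_eq_mul]
    push_cast
    ring

theorem isDirectSumOf_of_even_of_odd (hr : 1 ≤ r) (hk : k = 2 ^ r) (hm2 : 2 ≤ m) (hn2 : 2 ≤ n)
    (hy : m = k * y) (hy' : n = k * y') (heven : 2 ∣ y) (hodd' : ¬ 2 ∣ y') :
    IsDirectSumOf (Dec hm hn) (k • q m n) ((2 * k) • q' m n) := by
  have hk0 : k ≠ 0 := by
    rw [hk]
    positivity
  have hk0' : (k : ℤ) ≠ 0 := by exact_mod_cast hk0
  have m1 := smul_mem_of_dvd Nat.prime_two hk hm2 hy heven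
    (D := Dec hm hn) (b := q m n) fun c hc => hc.smul_q_mem hm2 hn
  have m2 := two_mul_smul_mem Nat.prime_two hk hy' hodd'
    (D := Dec hm hn) (b := q' m n) fun c hc => hc.smul_q'_mem hn2 hm
  have h := isDirectSumOf_of hm2 hn2 (hm := hm) (hn := hn) (a := k) (a' := 0) (b := 0)
    (b' := 2 * k) (by simpa using hk0) (by simpa using m1) (by simpa using m2) fun φ hφ => ?_
  · rw [zero_smul, zero_smul, add_zero, zero_add] at h
    convert h using 1
    · rw [natCast_zsmul]
    · rw [← natCast_zsmul]
      push_cast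
      rfl
  · obtain ⟨e, e', rfl, h⟩ := exists_of_mem_Dec hk0 hm2 hn2 hy hy' hφ
    obtain ⟨s, hs⟩ := h (by rw [hk]; exact (even_two).pow_of_ne_zero (by omega))
    obtain ⟨v, hv⟩ := heven
    obtain ⟨v', hv'⟩ : ∃ v, y' = 2 * v + 1 := ⟨y' / 2, by omega⟩
    rw [hv, hv'] at hs
    push_cast at hs
    -- With `y` even and `y'` odd, the parity condition constrains `e'` alone.
    obtain ⟨t, ht⟩ : ∃ t, e' = 2 * t := ⟨s - v * e - v' * e', by linear_combination hs⟩
    refine ⟨e, t, ?_⟩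
    rw [ht]
    simp only [zsmul_eq_mul]
    push_cast
    ring

theorem padicValNat_two_eq (hk : k = 2 ^ r) (hy : m = k * y) (hy0 : y ≠ 0) :
    padicValNat 2 m = padicValNat 2 k + padicValNat 2 y := by
  rw [hy, padicValNat.mul (by rw [hk]; positivity) hy0]

theorem two_dvd_iff (hk : k = 2 ^ r) (hy : m = k * y) (hy0 : y ≠ 0) :
    2 ∣ y ↔ padicValNat 2 k < padicValNat 2 m := by
  rw [padicValNat_two_eq hk hy hy0, dvd_iff_padicValNat_ne_zero hy0]
  omega

end Prime

end TypeA

end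

theorem mainTheorem3 (p r k m n : ℕ) (hp : p.Prime) (hr : 1 ≤ r) (hk : k = p ^ r)
    (hm2 : 2 ≤ m) (hn2 : 2 ≤ n) (hm : k ∣ m) (hn : k ∣ n) :
    (TypeA.Q hm hn : Set (TypeA.Sym m n)) =
        {φ | ∃ d d' : ℤ, φ = d • TypeA.q m n + d' • TypeA.q' m n ∧
          ∃ t : ℤ, ((k : ℚ) - 1) / k * (m * d + n * d') = t * (2 * k)} ∧
      (p ≠ 2 ∨ (p = 2 ∧ padicValNat 2 k < min (padicValNat 2 m) (padicValNat 2 n)) →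
        TypeA.IsDirectSumOf (TypeA.Dec hm hn) (k • TypeA.q m n) (k • TypeA.q' m n)) ∧
      (p = 2 ∧ padicValNat 2 m = padicValNat 2 k ∧ padicValNat 2 n = padicValNat 2 k →
        TypeA.IsDirectSumOf (TypeA.Dec hm hn)
          (k • (TypeA.q m n - TypeA.q' m n)) (k • (TypeA.q m n + TypeA.q' m n))) ∧
      (p = 2 ∧ padicValNat 2 k < padicValNat 2 m ∧ padicValNat 2 n = padicValNat 2 k →
        TypeA.IsDirectSumOf (TypeA.Dec hm hn)
          (k • TypeA.q m n) ((2 * k) • TypeA.q' m n)) := by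
  have hk0 : k ≠ 0 := by
    rw [hk]
    exact (pow_pos hp.pos r).ne'
  obtain ⟨y, hy⟩ := id hm
  obtain ⟨y', hy'⟩ := id hn
  have hy0 : y ≠ 0 := by
    rintro rfl
    omega
  have hy0' : y' ≠ 0 := by
    rintro rfl
    omega
  refine ⟨TypeA.coe_Q_eq hk0 hm2 hn2 hm hn, ?_, ?_, ?_⟩
  · rintro (hp2 | ⟨rfl, hlt⟩)
    · exact TypeA.isDirectSumOf_of_mem hk0 hm2 hn2
        (TypeA.smul_mem_of_ne_two hp hp2 hk hm2 hy fun c hc => hc.smul_q_mem hm2 hn)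
        (TypeA.smul_mem_of_ne_two hp hp2 hk hn2 hy' fun c hc => hc.smul_q'_mem hn2 hm)
    · rw [lt_min_iff, ← TypeA.two_dvd_iff hk hy hy0, ← TypeA.two_dvd_iff hk hy' hy0'] at hlt
      exact TypeA.isDirectSumOf_of_mem hk0 hm2 hn2
        (TypeA.smul_mem_of_dvd hp hk hm2 hy hlt.1 fun c hc => hc.smul_q_mem hm2 hn)
        (TypeA.smul_mem_of_dvd hp hk hn2 hy' hlt.2 fun c hc => hc.smul_q'_mem hn2 hm)
  · rintro ⟨rfl, h1, h2⟩
    exact TypeA.isDirectSumOf_of_odd hr hk hm2 hn2 hy hy'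
      (fun h => by rw [TypeA.two_dvd_iff hk hy hy0] at h; omega)
      (fun h => by rw [TypeA.two_dvd_iff hk hy' hy0'] at h; omega)
  · rintro ⟨rfl, h1, h2⟩
    exact TypeA.isDirectSumOf_of_even_of_odd hr hk hm2 hn2 hy hy'
      ((TypeA.two_dvd_iff hk hy hy0).2 h1)
      (fun h => by rw [TypeA.two_dvd_iff hk hy' hy0'] at h; omega)
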